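/- **Model.** Let $G=(V,E)$ be a finite simple, undirected, connected graph with $n\ge 2$ nodes, $m$ edges and diameter $D$; at each node $v$ of degree $\delta_v$ the incident edges carry distinct port numbers $0,\dots,\delta_v-1$ (independently at the two endpoints), and $N(v,q)$ is the neighbour of $v$ behind port $q$. A single agent has a state in a finite set $\mathcal M$, and each node $v$ has a whiteboard with content in a finite set $\mathcal W_{\delta_v}$. At each step the agent, being at node $v_{\rm cur}$, reads $\delta_{v_{\rm cur}}$, the port $p_{\rm in}$ through which it arrived, its own state and the whiteboard of $v_{\rm cur}$; it then (possibly at random) updates its state and this whiteboard and moves through a port. A configuration consists of the location of the agent, $p_{\rm in}$, the agent state and all whiteboards. The cover time is the number of moves made before all nodes have been visited (the start node counts as visited). A randomized algorithm is a self-stabilizing exploration algorithm for a class of graphs if on each graph of the class, from every initial configuration, the agent visits all nodes with probability $1$. The memory spaces of the agent and of $v$ are $\log_2|\mathcal M|$ and $\log_2|\mathcal W_{\delta_v}|$ bits. **Algorithm $P_{\rm ran}(c)$**, for an integer $c\ge2$. The agent has a variable $\mathrm{self.color}\in\{1,\dots,c\}$; each node $v$ has variables $v.\mathrm{parent}\in\{\bot,0,\dots,\delta_v-1\}$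 and $v.\mathrm{color}\in\{1,\dots,c\}$. Put $\mathrm{next}(v,q)=(q+1)\bmod\delta_v$. 1. while true: 2. $\quad$ choose $\mathrm{self.color}$ uniformly at random from $\{1,\dots,c\}\setminus\{\mathrm{self.color}\}$ 3. $\quad$ $v_{\rm cur}.\mathrm{color}\gets\mathrm{self.color}$ 4. $\quad$ GoForward$(0)$ 5. $\quad$ while $\neg(v_{\rm cur}.\mathrm{parent}=\bot\ \wedge\ p_{\rm in}=\delta_{v_{\rm cur}}-1\ \wedge\ v_{\rm cur}.\mathrm{color}=\mathrm{self.color})$: 6. $\qquad$ if $v_{\rm cur}.\mathrm{color}\ne\mathrm{self.color}$: 7. $\qquad\quad$ $v_{\rm cur}.\mathrm{color}\gets\mathrm{self.color}$ 8. $\qquad\quad$ $v_{\rm cur}.\mathrm{parent}\gets p_{\rm in}$ 9. $\qquad\quad$ GoForward$(\mathrm{next}(v_{\rm cur},p_{\rm in}))$ 10. $\qquad$ else: 11. $\qquad\quad$ if $v_{\rm cur}.\mathrm{parent}=\mathrm{next}(v_{\rm cur},p_{\rm in})$: 12. $\qquad\qquad$ $v_{\rm cur}.\mathrm{parent}\gets\bot$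 13. $\qquad\qquad$ migrate to $N(v_{\rm cur},\mathrm{next}(v_{\rm cur},p_{\rm in}))$ 14. $\qquad\quad$ else: 15. $\qquad\qquad$ GoForward$(\mathrm{next}(v_{\rm cur},p_{\rm in}))$ 16. function GoForward$(q)$: 17. $\quad$ migrate to $N(v_{\rm cur},q)$ 18. $\quad$ if $v_{\rm cur}.\mathrm{color}=\mathrm{self.color}$: 19. $\qquad$ migrate to $N(v_{\rm cur},p_{\rm in})$ The agent state consists of $\mathrm{self.color}$, the program counter (the line 13, 17 or 19 of the last migration) and the call stack (the line 4, 9 or 15 from which GoForward was called); the whiteboard of $v$ consists of $v.\mathrm{parent}$ and $v.\mathrm{color}$. In an initial configuration all of these, $p_{\rm in}$ and the location of the agent are arbitrary. **Theorem.** There is a universal constant $C$ such that for every integer $c\ge2$ the following hold. * $P_{\rm ran}(c)$ is a randomized self-stabilizing exploration algorithm for all simple, undirected, connected port-labelled graphs. * On every such graph and from every initial configuration, the cover time is at most $C\,mD$ with probability $1$. * On every such graph and from every initial configuration, the expected cover time is at most $$C\cdot\min\Bigl(m\Bigl\lceil \frac{n}{\max(c-n,\;n/D)}\Bigr\rceil,\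 m\Bigl\lceil \frac Dc\Bigr\rceil\log n\Bigr).$$ * The agent memory space is at most $C\log c$ bits, and the memory space of each node $v$ is at most $C(\log c+\log\delta_v)$ bits. -/

import Mathlib

open scoped ENNReal

universe u

/-- A finite, simple, undirected, connected graph with port labels. -/
structure PortGraph where
  V : Type u
  [fintypeV : Fintype V]
  [decEqV : DecidableEq V]
  graph : SimpleGraph V
  [decAdj : DecidableRel graph.Adj]
  connected : graph.Connected
  /-- `port v` numbers the edges incident to `v` (given by their other endpoint)
  bijectively by `0, …, δ_v - 1`. -/
  port : ∀ v, graph.neighborSet v ≃ Fin (graph.degree v)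

attribute [instance] PortGraph.fintypeV PortGraph.decEqV PortGraph.decAdj

namespace PortGraph

/-- The degree `δ_v`. -/
abbrev deg (G : PortGraph.{u}) (v : G.V) : ℕ := G.graph.degree v

/-- The number `n` of nodes. -/
abbrev numNodes (G : PortGraph.{u}) : ℕ := Fintype.card G.V

/-- The number `m` of edges. -/
abbrev numEdges (G : PortGraph.{u}) : ℕ := G.graph.edgeFinset.card

/-- The diameter `D`. -/
noncomputable abbrev diam (G : PortGraph.{u}) : ℕ := G.graph.diam

/-- The `q`-th neighbour `N(v, q)` of `v`. -/
def nbr (G : PortGraph.{u}) (v : G.V) (q : Fin (G.deg v)) : G.V := (G.port v).symm q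

theorem adj_nbr (G : PortGraph.{u}) (v : G.V) (q : Fin (G.deg v)) :
    G.graph.Adj v (G.nbr v q) := ((G.port v).symm q).2

/-- The port number that the edge leaving `v` through port `q` has at its other endpoint. -/
def backPort (G : PortGraph.{u}) (v : G.V) (q : Fin (G.deg v)) : Fin (G.deg (G.nbr v q)) :=
  G.port (G.nbr v q) ⟨v, (G.adj_nbr v q).symm⟩

end PortGraph

/-- A (randomized) algorithm `(φ, M, W)` for a single agent: `M` is the set of agent states,
`W k` is the set of whiteboard states of a node of degree `k`, and `φ` maps the degree of the
current node, the in-port, the agent state and the whiteboard of the current node to a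
distribution of (out-port, new agent state, new whiteboard). -/
structure AgentAlgorithm where
  M : Type
  W : ℕ → Type
  [finiteM : Finite M]
  [finiteW : ∀ k, Finite (W k)]
  φ : (d : ℕ) → Fin d → M → W d → PMF (Fin d × M × W d)

namespace AgentAlgorithm

/-- The agent memory space, in bits. -/
noncomputable def agentMemory (A : AgentAlgorithm) : ℝ := Real.logb 2 (Nat.card A.M)

/-- The whiteboard memory space of a node of degree `d`, in bits. -/
noncomputable def whiteboardMemory (A : AgentAlgorithm) (d : ℕ) : ℝ :=
  Real.logb 2 (Nat.card (A.W d))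

/-- A configuration: the location of the agent, the in-port, the agent state, and the
whiteboards of all nodes. -/
@[ext]
structure Config (A : AgentAlgorithm) (G : PortGraph.{u}) where
  loc : G.V
  pin : Fin (G.deg loc)
  mem : A.M
  wb : ∀ v, A.W (G.deg v)

variable {A : AgentAlgorithm} {G : PortGraph.{u}}

/-- The configuration reached from `γ` by writing `s` to the agent memory and `x` to the
whiteboard of the current node, and then moving through port `q`. -/
def Config.move (γ : Config A G) (q : Fin (G.deg γ.loc)) (s : A.M) (x : A.W (G.deg γ.loc)) :
    Config A G where
  loc := G.nbr γ.loc q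
  pin := G.backPort γ.loc q
  mem := s
  wb := Function.update γ.wb γ.loc x

/-- The distribution of the configuration after one move. -/
noncomputable def Config.step (γ : Config A G) : PMF (Config A G) :=
  (A.φ (G.deg γ.loc) γ.pin γ.mem (γ.wb γ.loc)).map fun r => γ.move r.1 r.2.1 r.2.2

instance : MeasurableSpace (Config A G) := ⊤

/-- The one-step transition kernel of the Markov chain of configurations. -/
noncomputable def stepKernel (A : AgentAlgorithm) (G : PortGraph.{u}) :
    ProbabilityTheory.Kernel (Config A G) (Config A G) where
  toFun γ := γ.step.toMeasure
  measurable' := measurable_from_top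

instance : ProbabilityTheory.IsMarkovKernel (stepKernel A G) :=
  ⟨fun γ => inferInstanceAs (MeasureTheory.IsProbabilityMeasure γ.step.toMeasure)⟩

/-- The transition kernel at time `n` as a kernel of the whole history up to time `n`; it only
depends on the configuration at time `n`. -/
noncomputable def historyKernel (A : AgentAlgorithm) (G : PortGraph.{u}) (n : ℕ) :
    ProbabilityTheory.Kernel (∀ _ : Finset.Iic n, Config A G) (Config A G) :=
  (stepKernel A G).comap (fun h => h ⟨n, Finset.mem_Iic.2 le_rfl⟩) (measurable_pi_apply _)

instance (n : ℕ) : ProbabilityTheory.IsMarkovKernel (historyKernel A G n) :=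
  inferInstanceAs (ProbabilityTheory.IsMarkovKernel ((stepKernel A G).comap _ _))

/-- The law of the execution `ω 0, ω 1, ω 2, …` that starts from the configuration `γ`. -/
noncomputable def execution (γ : Config A G) : MeasureTheory.Measure (ℕ → Config A G) :=
  ProbabilityTheory.Kernel.traj (X := fun _ => Config A G) (historyKernel A G) 0 fun _ => γ

/-- The cover time of a run: the least number `t` of moves such that each node is the location
of the agent at some time `s ≤ t` (`⊤` if there is no such `t`). -/
noncomputable def coverTime (ω : ℕ → Config A G) : ℕ∞ :=
  ⨅ t ∈ {t : ℕ | ∀ v : G.V, ∃ s ≤ t, (ω s).loc = v}, (t : ℕ∞)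

/-- The expected cover time of the execution from `γ`. -/
noncomputable def expectedCoverTime (γ : Config A G) : ℝ≥0∞ :=
  ∫⁻ ω, (coverTime ω : ℝ≥0∞) ∂(execution γ)

/-- `A` is a (randomized) self-stabilizing exploration algorithm for the class `𝒢`: from any
configuration on any graph of `𝒢`, the agent eventually visits all nodes, almost surely. -/
def IsSelfStabilizingExploration (A : AgentAlgorithm) (𝒢 : Set PortGraph.{u}) : Prop :=
  ∀ G ∈ 𝒢, ∀ γ : Config A G, ∀ᵐ ω ∂(execution γ), ∀ v : G.V, ∃ t, (ω t).loc = v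

end AgentAlgorithm

namespace Pran

/-!
The algorithm `P_ran(c)`. Agent variable: `self.color`. Whiteboard variables: `v.parent` and
`v.color`. With `next(v, q) = (q + 1) mod δ_v`, and `cur` the current node, the program is

```
 1  while true
 2    choose self.color uniformly from {1, …, c} minus self.color
 3    cur.color := self.color
 4    GoForward(0)
 5    while not (cur.parent = ⊥ and pin = δ_cur - 1 and cur.color = self.color)
 6      if cur.color ≠ self.color
 7        cur.color := self.color
 8        cur.parent := pin
 9        GoForward(next(cur, pin))
10      else
11        if cur.parent = next(cur, pin)
12          cur.parent := ⊥
13          migrate to N(cur, next(cur, pin))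
14        else
15          GoForward(next(cur, pin))
16  function GoForward(q)
17    migrate to N(cur, q)
18    if cur.color = self.color
19      migrate to N(cur, pin)
```

The conjunct `cur.color = self.color` in line 5 says that a traversal is ended only at a node
that already has the colour of that traversal: a node of another colour is always treated as
unvisited (lines 6-9).
-/

/-- The line from which `GoForward` has been called. -/
inductive Caller
  | line4
  | line9
  | line15
  deriving DecidableEq

instance : Fintype Caller :=
  ⟨{.line4, .line9, .line15}, fun x => by cases x <;> simp⟩

/-- The program counter (the line of the last migration) with the call stack. -/
inductive Counter
  | line13
  | line17 (caller : Caller)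
  | line19 (caller : Caller)
  deriving Fintype

/-- The agent state: `self.color`, program counter and call stack. -/
structure Memory (c : ℕ) where
  color : Fin c
  counter : Counter
  deriving Fintype

/-- The whiteboard of a node of degree `d`; the value `none` of `parent` stands for `⊥`. -/
structure Board (c d : ℕ) where
  parent : Option (Fin d)
  color : Fin c
  deriving Fintype

/-- `next(v, q) = (q + 1) mod δ_v`. -/
def next {d : ℕ} (q : Fin d) : Fin d := ⟨(q + 1) % d, Nat.mod_lt _ q.pos⟩

theorem erase_nonempty {c : ℕ} (hc : 2 ≤ c) (r : Fin c) : (Finset.univ.erase r).Nonempty := by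
  rw [← Finset.card_pos, Finset.card_erase_of_mem (Finset.mem_univ r), Finset.card_univ,
    Fintype.card_fin]
  omega

/-- The computation from the test in line 5 up to the next migration. -/
noncomputable def loopTest {c : ℕ} (hc : 2 ≤ c) (d : ℕ) (pin : Fin d) (self : Memory c)
    (cur : Board c d) : PMF (Fin d × Memory c × Board c d) :=
  if cur.parent = none ∧ (pin : ℕ) = d - 1 ∧ cur.color = self.color then
    (PMF.uniformOfFinset (Finset.univ.erase self.color) (erase_nonempty hc self.color)).map
      fun r => (⟨0, pin.pos⟩, ⟨r, .line17 .line4⟩, ⟨cur.parent, r⟩)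
  else if cur.color ≠ self.color then
    PMF.pure (next pin, ⟨self.color, .line17 .line9⟩, ⟨some pin, self.color⟩)
  else if cur.parent = some (next pin) then
    PMF.pure (next pin, ⟨self.color, .line13⟩, ⟨none, cur.color⟩)
  else
    PMF.pure (next pin, ⟨self.color, .line17 .line15⟩, cur)

/-- The computation of the agent between its arrival at a node and the next migration. -/
noncomputable def transition {c : ℕ} (hc : 2 ≤ c) (d : ℕ) (pin : Fin d) (self : Memory c)
    (cur : Board c d) : PMF (Fin d × Memory c × Board c d) :=
  match self.counter with
  | .line17 caller =>
    if cur.color = self.color then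
      PMF.pure (pin, ⟨self.color, .line19 caller⟩, cur)
    else
      loopTest hc d pin self cur
  | .line13 => loopTest hc d pin self cur
  | .line19 _ => loopTest hc d pin self cur

/-- The algorithm `P_ran(c)`. -/
noncomputable def algorithm (c : ℕ) (hc : 2 ≤ c) : AgentAlgorithm where
  M := Memory c
  W := Board c
  finiteM := inferInstance
  finiteW := fun _ => inferInstance
  φ := transition hc

end Pran

/-
A traversal with a colour `y` that is new at the root is a depth-first search of the nodes that can
be reached from the root through nodes whose colour is not `y`: it recolours these nodes, sees all
their neighbours, clears all the parents that it sets, and ends at the root. From an arbitrary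
configuration the agent also ends a traversal after `O(m)` moves: between two moves to a parent it
only circles around nodes that already have its colour, and a node that is left for its parent has
none afterwards, until it is recoloured.

Once a traversal has ended, its root lies in a connected set `R` of visited nodes of one colour, and
the next traversal extends `R` to a set that contains all the neighbours of `R`. So `D` further
traversals, of `O(m)` moves each, visit all nodes.

For the expectation, a traversal with a colour that no node has visits all nodes; when `c > n`, this
happens with probability at least `(c - n) / (c - 1)`. In general, fix a shortest path from `R` to a
node `v`. A traversal that does not visit `v` visits a node of its own colour on this path, so the
traversals with different colours that miss `v` get to different distances from `v`. Hence the
weight `(c / (c - 1)) ^ dist(v, R)`, replaced by `0` once `v` is in `R`, shrinks on average by the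
factor `2 / 3` in each traversal, and the logarithm of the total weight bounds the expected number
of traversals.
-/

namespace AgentAlgorithm

open MeasureTheory ProbabilityTheory

variable {A : AgentAlgorithm} {G : PortGraph.{u}}

instance : Finite (Config A G) := by
  have := A.finiteM
  have := A.finiteW
  refine Finite.of_injective
    (fun γ : Config A G =>
      ((⟨γ.loc, γ.pin⟩, γ.mem, γ.wb) : (Σ v : G.V, Fin (G.deg v)) × A.M × ∀ v, A.W (G.deg v))) ?_
  rintro ⟨l, p, s, w⟩ ⟨l', p', s', w'⟩ h
  simp only [Prod.mk.injEq, Sigma.mk.injEq] at h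
  obtain ⟨⟨rfl, h⟩, rfl, rfl⟩ := h
  obtain rfl := eq_of_heq h
  rfl

instance : DiscreteMeasurableSpace (Config A G) := ⟨fun _ => trivial⟩

/-- The set of nodes visited by the run `ω` up to time `t`. -/
def visited (ω : ℕ → Config A G) (t : ℕ) : Finset G.V :=
  (Finset.range (t + 1)).image fun s => (ω s).loc

theorem mem_visited {ω : ℕ → Config A G} {t : ℕ} {v : G.V} :
    v ∈ visited ω t ↔ ∃ s ≤ t, (ω s).loc = v := by
  simp [visited]

theorem visited_succ (ω : ℕ → Config A G) (t : ℕ) :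
    visited ω (t + 1) = insert (ω (t + 1)).loc (visited ω t) := by
  rw [visited, Finset.range_add_one, Finset.image_insert, visited]

theorem visited_mono (ω : ℕ → Config A G) : Monotone (visited ω) := fun _ _ h =>
  Finset.image_subset_image (Finset.range_mono (by omega))

theorem visited_eq_of_eqOn {ω ω' : ℕ → Config A G} {t : ℕ} (h : ∀ s ≤ t, ω s = ω' s) :
    visited ω t = visited ω' t := by
  ext v
  simp only [mem_visited]
  exact exists_congr fun s => and_congr_right fun hs => by rw [h s hs]

theorem coverTime_le_iff {ω : ℕ → Config A G} {t : ℕ} :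
    coverTime ω ≤ t ↔ visited ω t = Finset.univ := by
  have key : ∀ s : ℕ, s ∈ {t : ℕ | ∀ v : G.V, ∃ s ≤ t, (ω s).loc = v} ↔
      visited ω s = Finset.univ := by
    intro s
    simp [Finset.eq_univ_iff_forall, mem_visited]
  constructor
  · intro h
    have h' : coverTime ω < ((t + 1 : ℕ) : ℕ∞) :=
      lt_of_le_of_lt h (by exact_mod_cast t.lt_succ_self)
    simp only [coverTime, iInf_lt_iff] at h'
    obtain ⟨s, hs, hst⟩ := h'
    have hst : s ≤ t := Nat.lt_succ_iff.1 (by exact_mod_cast hst)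
    exact Finset.univ_subset_iff.1 ((key s).1 hs ▸ visited_mono ω hst)
  · intro h
    exact iInf₂_le t ((key t).2 h)

/-- `uncovered t γ W` is the probability that some node is neither in `W` nor visited within
`t` moves from `γ`. -/
noncomputable def uncovered : ℕ → Config A G → Finset G.V → ℝ≥0∞
  | 0, _, W => if W = Finset.univ then 0 else 1
  | t + 1, γ, W => ∫⁻ γ', uncovered t γ' (insert γ'.loc W) ∂γ.step.toMeasure

theorem uncovered_univ (t : ℕ) (γ : Config A G) : uncovered t γ Finset.univ = 0 := by
  induction t generalizing γ with
  | zero => simp [uncovered]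
  | succ t ih => simp [uncovered, ih]

theorem uncovered_le_one (t : ℕ) (γ : Config A G) (W : Finset G.V) : uncovered t γ W ≤ 1 := by
  induction t generalizing γ W with
  | zero => simp only [uncovered]; split_ifs <;> simp
  | succ t ih =>
    refine (lintegral_mono fun γ' => ih γ' _).trans ?_
    simp

theorem uncovered_succ_le (t : ℕ) (γ : Config A G) (W : Finset G.V) :
    uncovered (t + 1) γ W ≤ uncovered t γ W := by
  induction t generalizing γ W with
  | zero =>
    by_cases hW : W = Finset.univ
    · subst hW; simp [uncovered_univ]
    · rw [show uncovered 0 γ W = 1 by simp [uncovered, hW]]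
      exact uncovered_le_one _ _ _
  | succ t ih => exact lintegral_mono fun γ' => ih γ' _

theorem uncovered_antitone (γ : Config A G) (W : Finset G.V) :
    Antitone fun t => uncovered t γ W :=
  antitone_nat_of_succ_le fun t => uncovered_succ_le t γ W

theorem uncovered_succ_of_pure {γ γ' : Config A G} (h : γ.step = PMF.pure γ') (t : ℕ)
    (W : Finset G.V) : uncovered (t + 1) γ W = uncovered t γ' (insert γ'.loc W) := by
  rw [uncovered, h, PMF.toMeasure_pure, lintegral_dirac' _ measurable_from_top]

theorem measurable_visited (t : ℕ) :
    @Measurable _ _ _ ⊤ (fun ω : ℕ → Config A G => visited ω t) := by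
  induction t with
  | zero =>
    let _ : MeasurableSpace (Finset G.V) := ⊤
    have : (fun ω : ℕ → Config A G => visited ω 0) = (fun γ => {γ.loc}) ∘ fun ω => ω 0 := by
      funext ω; simp [visited]
    rw [this]
    exact measurable_from_top.comp (measurable_pi_apply 0)
  | succ t ih =>
    let _ : MeasurableSpace (Finset G.V) := ⊤
    have : (fun ω : ℕ → Config A G => visited ω (t + 1)) =
        (fun p : Config A G × Finset G.V => insert p.1.loc p.2) ∘
          fun ω => (ω (t + 1), visited ω t) := by
      funext ω; simp [visited_succ]
    rw [this]
    exact (measurable_of_countable _).comp ((measurable_pi_apply _).prodMk ih)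

theorem measurableSet_visited (t : ℕ) :
    MeasurableSet {ω : ℕ → Config A G | visited ω t ≠ Finset.univ} :=
  measurable_visited t (MeasurableSpace.measurableSet_top (s := {W | W ≠ Finset.univ}))

theorem lmarginalPartialTraj_visited (k a : ℕ) (ω : ℕ → Config A G) :
    Kernel.lmarginalPartialTraj (X := fun _ => Config A G) (historyKernel A G) a (a + k)
      ({ω | visited ω (a + k) ≠ Finset.univ}.indicator 1) ω =
      uncovered k (ω a) (visited ω a) := by
  induction k generalizing a ω with
  | zero =>
    rw [Kernel.lmarginalPartialTraj_le _ (by omega)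
      (measurable_one.indicator (measurableSet_visited _))]
    by_cases h : visited ω a = Finset.univ <;> simp [uncovered, h]
  | succ k ih =>
    have hm := (measurable_one (α := ℝ≥0∞)).indicator
      (measurableSet_visited (A := A) (G := G) (a + (k + 1)))
    have e : a + (k + 1) = a + 1 + k := by omega
    rw [← Kernel.lmarginalPartialTraj_self (b := a + 1) (by omega) (by omega) hm]
    have h2 : Kernel.lmarginalPartialTraj (X := fun _ => Config A G) (historyKernel A G)
        (a + 1) (a + (k + 1)) ({ω | visited ω (a + (k + 1)) ≠ Finset.univ}.indicator 1) =
        fun ω => uncovered k (ω (a + 1)) (visited ω (a + 1)) := by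
      funext ω
      rw [e]
      exact ih (a + 1) ω
    rw [h2, Kernel.lmarginalPartialTraj_succ]
    · rw [uncovered]
      change ∫⁻ x, _ ∂(stepKernel A G (ω a)) = _
      refine lintegral_congr fun x => ?_
      have : visited (Function.update ω (a + 1) x) a = visited ω a :=
        visited_eq_of_eqOn fun s hs => Function.update_of_ne (by omega) _ _
      rw [visited_succ, this, Function.update_self]
    · let _ : MeasurableSpace (Finset G.V) := ⊤
      exact (measurable_of_countable
        (fun p : Config A G × Finset G.V => uncovered k p.1 p.2)).comp
        ((measurable_pi_apply (a + 1)).prodMk (measurable_visited (a + 1)))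

theorem execution_visited_ne_univ (γ : Config A G) (t : ℕ) :
    execution γ {ω | visited ω t ≠ Finset.univ} = uncovered t γ {γ.loc} := by
  have h := lmarginalPartialTraj_visited t 0 (fun _ : ℕ => γ)
  rw [show visited (fun _ : ℕ => γ) 0 = {γ.loc} by simp [visited]] at h
  rw [← h, ← lintegral_indicator_one (measurableSet_visited t), Kernel.lmarginalPartialTraj,
    zero_add]
  have hf : Preorder.frestrictLe (π := fun _ => Config A G) 0 (fun _ => γ) = fun _ => γ := rfl
  rw [hf, ← Kernel.traj_map_frestrictLe_apply, lintegral_map, execution]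
  · refine lintegral_congr fun ω => ?_
    have : visited (Function.updateFinset (fun _ => γ) (Finset.Iic t)
        (Preorder.frestrictLe t ω)) t = visited ω t := by
      refine visited_eq_of_eqOn fun s hs => ?_
      simp [Function.updateFinset, hs]
    by_cases hc : visited ω t = Finset.univ <;> simp [Set.indicator, this, hc]
  · exact (measurable_one.indicator (measurableSet_visited t)).comp measurable_updateFinset
  · fun_prop

theorem ae_coverTime_le {γ : Config A G} {t : ℕ} (h : uncovered t γ {γ.loc} = 0) :
    ∀ᵐ ω ∂(execution γ), coverTime ω ≤ t := by
  rw [← execution_visited_ne_univ, measure_eq_zero_iff_ae_notMem] at h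
  filter_upwards [h] with ω hω
  exact coverTime_le_iff.2 (by simpa using hω)

theorem coverTime_eq_tsum (ω : ℕ → Config A G) :
    (coverTime ω : ℝ≥0∞) =
      ∑' t, {ω | visited ω t ≠ Finset.univ}.indicator (fun _ => (1 : ℝ≥0∞)) ω := by
  have key : ∀ t, {ω | visited ω t ≠ Finset.univ}.indicator (fun _ => (1 : ℝ≥0∞)) ω =
      if coverTime ω ≤ t then 0 else 1 := by
    intro t
    by_cases h : visited ω t = Finset.univ
    · simp [h, coverTime_le_iff.2 h]
    · simp [h, mt coverTime_le_iff.1 h]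
  simp only [key]
  cases hT : coverTime ω with
  | top => simp
  | coe T =>
    rw [tsum_eq_sum (s := Finset.range T)]
    · rw [Finset.sum_congr rfl (g := fun _ => (1 : ℝ≥0∞))]
      · simp
      · intro t ht
        rw [if_neg]
        simpa using ht
    · intro t ht
      rw [if_pos]
      simpa using ht

theorem expectedCoverTime_eq_tsum (γ : Config A G) :
    expectedCoverTime γ = ∑' t, uncovered t γ {γ.loc} := by
  simp only [expectedCoverTime, coverTime_eq_tsum]
  rw [lintegral_tsum fun t => (measurable_const.indicator (measurableSet_visited t)).aemeasurable]
  refine tsum_congr fun t => ?_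
  rw [lintegral_indicator_const (measurableSet_visited t), one_mul, execution_visited_ne_univ]

theorem lintegral_map_uniformOfFinset {α β : Type*} [Finite α] [MeasurableSpace β]
    [DiscreteMeasurableSpace β] (s : Finset α) (hs : s.Nonempty) (f : α → β) (F : β → ℝ≥0∞) :
    ∫⁻ z, F z ∂((PMF.uniformOfFinset s hs).map f).toMeasure =
      (s.card : ℝ≥0∞)⁻¹ * ∑ y ∈ s, F (f y) := by
  have := Fintype.ofFinite α
  let _ : MeasurableSpace α := ⊤
  rw [← PMF.toMeasure_map (PMF.uniformOfFinset s hs) (f := f) .of_discrete,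
    lintegral_map .of_discrete .of_discrete, lintegral_fintype, Finset.mul_sum,
    ← Finset.sum_subset (Finset.subset_univ s)]
  · refine Finset.sum_congr rfl fun y hy => ?_
    rw [PMF.toMeasure_apply_singleton _ _ (MeasurableSet.singleton y),
      PMF.uniformOfFinset_apply_of_mem hs hy, mul_comm]
  · intro y _ hy
    rw [PMF.toMeasure_apply_singleton _ _ (MeasurableSet.singleton y),
      PMF.uniformOfFinset_apply_of_notMem hs hy, mul_zero]

/-- The expected cover time truncated at `T`, when the nodes of `W` count as visited. -/
noncomputable def truncatedCoverTime (T : ℕ) (γ : Config A G) (W : Finset G.V) : ℝ≥0∞ :=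
  ∑ t ∈ Finset.range T, uncovered t γ W

theorem truncatedCoverTime_mono {T T' : ℕ} (h : T ≤ T') (γ : Config A G) (W : Finset G.V) :
    truncatedCoverTime T γ W ≤ truncatedCoverTime T' γ W :=
  Finset.sum_le_sum_of_subset (Finset.range_mono h)

theorem truncatedCoverTime_univ (T : ℕ) (γ : Config A G) :
    truncatedCoverTime T γ Finset.univ = 0 := by
  simp [truncatedCoverTime, uncovered_univ]

theorem truncatedCoverTime_succ_le (T : ℕ) (γ : Config A G) (W : Finset G.V) :
    truncatedCoverTime (T + 1) γ W ≤
      ∫⁻ γ', (1 + truncatedCoverTime T γ' (insert γ'.loc W)) ∂γ.step.toMeasure := by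
  have hint : ∫⁻ γ', truncatedCoverTime T γ' (insert γ'.loc W) ∂γ.step.toMeasure =
      ∑ t ∈ Finset.range T, uncovered (t + 1) γ W :=
    lintegral_finsetSum _ fun _ _ => measurable_from_top
  rw [lintegral_add_left measurable_const, lintegral_const, measure_univ, mul_one, hint,
    truncatedCoverTime, Finset.sum_range_succ', add_comm]
  gcongr
  exact uncovered_le_one _ _ _

theorem expectedCoverTime_le_of_truncated {γ : Config A G} {b : ℝ≥0∞}
    (h : ∀ T, truncatedCoverTime T γ {γ.loc} ≤ b) : expectedCoverTime γ ≤ b := by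
  rw [expectedCoverTime_eq_tsum]
  exact ENNReal.summable.tsum_le_of_sum_range_le h

/-- `Run k γ W γ' W'`: the first `k` moves from `γ` are deterministic and lead to `γ'`; if the
nodes of `W` are visited before, then those of `W'` are visited after these moves. -/
inductive Run : ℕ → Config A G → Finset G.V → Config A G → Finset G.V → Prop
  | refl (γ : Config A G) (W : Finset G.V) : Run 0 γ W γ W
  | step {k : ℕ} {γ γ' γ'' : Config A G} {W W' : Finset G.V} (h : γ.step = PMF.pure γ')
      (hr : Run k γ' (insert γ'.loc W) γ'' W') : Run (k + 1) γ W γ'' W'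

namespace Run

variable {k l : ℕ} {γ γ' γ'' : Config A G} {W W' W'' : Finset G.V}

theorem single (h : γ.step = PMF.pure γ') : Run 1 γ W γ' (insert γ'.loc W) :=
  .step h (.refl _ _)

theorem trans (h : Run k γ W γ' W') (h' : Run l γ' W' γ'' W'') : Run (k + l) γ W γ'' W'' := by
  induction h with
  | refl => simpa using h'
  | step hs _ ih =>
    rw [Nat.add_right_comm]
    exact .step hs (ih h')

theorem visited_subset (h : Run k γ W γ' W') : W ⊆ W' := by
  induction h with
  | refl => exact subset_rfl
  | step _ _ ih => exact (Finset.subset_insert _ _).trans ih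

theorem loc_mem (h : Run k γ W γ' W') (hγ : γ.loc ∈ W) : γ'.loc ∈ W' := by
  induction h with
  | refl => exact hγ
  | step _ _ ih => exact ih (Finset.mem_insert_self _ _)

theorem uncovered_add (h : Run k γ W γ' W') (t : ℕ) :
    uncovered (k + t) γ W = uncovered t γ' W' := by
  induction h with
  | refl => simp
  | step hs _ ih => rw [Nat.add_right_comm, uncovered_succ_of_pure hs, ih]

theorem truncatedCoverTime_le (h : Run k γ W γ' W') (T : ℕ) :
    truncatedCoverTime T γ W ≤ k + truncatedCoverTime T γ' W' := by
  induction h with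
  | refl => simp
  | @step k γ γ' γ'' W W' hs _ ih =>
    calc truncatedCoverTime T γ W
        ≤ truncatedCoverTime (T + 1) γ W := truncatedCoverTime_mono T.le_succ γ W
      _ ≤ 1 + truncatedCoverTime T γ' (insert γ'.loc W) := by
          refine (truncatedCoverTime_succ_le T γ W).trans_eq ?_
          rw [hs, PMF.toMeasure_pure, lintegral_dirac' _ measurable_from_top]
      _ ≤ 1 + (k + truncatedCoverTime T γ'' W') := by gcongr
      _ = ↑(k + 1) + truncatedCoverTime T γ'' W' := by push_cast; ring

end Run

end AgentAlgorithm

namespace PortGraph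

variable (G : PortGraph.{u})

/-- A node with one of its ports. -/
abbrev Flag : Type u := Σ v : G.V, Fin (G.deg v)

variable {G}

/-- The other end of the edge behind a port. -/
def otherEnd (a : G.Flag) : G.Flag := ⟨G.nbr a.1 a.2, G.backPort a.1 a.2⟩

theorem nbr_port {v w : G.V} (h : G.graph.Adj v w) : G.nbr v (G.port v ⟨w, h⟩) = w := by
  simp [nbr]

theorem exists_nbr_eq {v w : G.V} (h : G.graph.Adj v w) : ∃ q, G.nbr v q = w :=
  ⟨_, nbr_port h⟩

theorem otherEnd_port {v w : G.V} (h : G.graph.Adj v w) :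
    otherEnd (⟨v, G.port v ⟨w, h⟩⟩ : G.Flag) = ⟨w, G.port w ⟨v, h.symm⟩⟩ := by
  have key : ∀ z : G.graph.neighborSet v, z = ⟨w, h⟩ →
      (⟨z.1, G.port z.1 ⟨v, z.2.symm⟩⟩ : G.Flag) = ⟨w, G.port w ⟨v, h.symm⟩⟩ := by
    rintro _ rfl
    rfl
  exact key _ ((G.port v).symm_apply_apply _)

@[simp]
theorem otherEnd_otherEnd (a : G.Flag) : otherEnd (otherEnd a) = a := by
  obtain ⟨v, q⟩ := a
  obtain ⟨⟨w, h⟩, rfl⟩ := (G.port v).surjective q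
  rw [otherEnd_port h, otherEnd_port h.symm]

theorem nontrivial_of_port {v : G.V} (q : Fin (G.deg v)) : Nontrivial G.V :=
  ⟨v, G.nbr v q, (G.adj_nbr v q).ne⟩

theorem card_le_two_mul_numEdges [Nontrivial G.V] : G.numNodes ≤ 2 * G.numEdges := by
  rw [numEdges, ← G.graph.sum_degrees_eq_twice_card_edges, numNodes, ← Finset.card_univ,
    Finset.card_eq_sum_ones]
  exact Finset.sum_le_sum fun v _ => G.connected.preconnected.degree_pos_of_nontrivial v

theorem numEdges_pos [Nontrivial G.V] : 0 < G.numEdges := by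
  have := (Fintype.card_pos (α := G.V)).trans_le G.card_le_two_mul_numEdges
  omega

theorem diam_pos [Nontrivial G.V] : 0 < G.diam :=
  Nat.pos_of_ne_zero (SimpleGraph.connected_iff_diam_ne_zero.1 G.connected)

end PortGraph

namespace Pran

open SimpleGraph

theorem sum_le_sum_range_card {M : Type*} [AddCommMonoid M] [PartialOrder M]
    [IsOrderedAddMonoid M] {f : ℕ → M} (hf : Antitone f) (J : Finset ℕ) :
    ∑ j ∈ J, f j ≤ ∑ i ∈ Finset.range J.card, f i := by
  induction J using Finset.induction_on_max with
  | empty => simp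
  | insert m J hm ih =>
    have hmJ : m ∉ J := fun h => lt_irrefl _ (hm m h)
    have hcard : J.card ≤ m := by
      simpa using Finset.card_le_card fun j hj => Finset.mem_range.2 (hm j hj)
    rw [Finset.sum_insert hmJ, Finset.card_insert_of_notMem hmJ, Finset.sum_range_succ, add_comm]
    exact add_le_add ih (hf hcard)

section Growth

variable {V C : Type*} {H : SimpleGraph V} {κ : V → C} {y : C} {R R' : Finset V} {u v w : V}

/-- What a traversal with colour `y` does to the set of nodes known to be visited, when `κ` is the
colouring before it: the traversal enters a superset `A` of `R`, misses a neighbour of `A` only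
if that neighbour has colour `y`, and visits all neighbours of `A`. -/
def Grows (H : SimpleGraph V) (κ : V → C) (y : C) (R R' : Finset V) : Prop :=
  ∃ A : Finset V, R ⊆ A ∧ A ⊆ R' ∧ ∀ u ∈ A, ∀ w, H.Adj u w → w ∈ R' ∧ (w ∈ A ∨ κ w = y)

namespace Grows

theorem subset (h : Grows H κ y R R') : R ⊆ R' :=
  let ⟨_, hRA, hAR', _⟩ := h
  hRA.trans hAR'

theorem mem_of_adj (h : Grows H κ y R R') (hu : u ∈ R) (huw : H.Adj u w) : w ∈ R' :=
  let ⟨_, hRA, _, hA⟩ := h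
  (hA u (hRA hu) w huw).1

theorem exists_getVert (h : Grows H κ y R R') (hu : u ∈ R) (p : H.Walk u v) (hv : v ∉ R') :
    ∃ j < p.length, κ (p.getVert (j + 1)) = y ∧ p.getVert (j + 1) ∈ R' := by
  obtain ⟨A, hRA, hAR', hA⟩ := h
  replace hu := hRA hu
  clear hRA
  induction p with
  | nil => exact absurd (hAR' hu) hv
  | @cons u w v huw p ih =>
    obtain ⟨hwR', hwA | hκ⟩ := hA u hu w huw
    · obtain ⟨j, hj, hκ, hR'⟩ := ih hv hwA
      exact ⟨j + 1, by simpa using hj, by simpa using hκ, by simpa using hR'⟩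
    · exact ⟨0, by simp, by simpa using hκ, by simpa using hwR'⟩

theorem eq_univ [Fintype V] (h : Grows H κ y R R') (hH : H.Connected) (hR : R.Nonempty)
    (hy : ∀ v, κ v ≠ y) : R' = Finset.univ := by
  obtain ⟨u, hu⟩ := hR
  refine Finset.eq_univ_of_forall fun v => by_contra fun hv => ?_
  obtain ⟨p⟩ := hH.preconnected u v
  obtain ⟨j, -, hκ, -⟩ := h.exists_getVert hu p hv
  exact hy _ hκ

end Grows

/-- The distance from the set `R` to the node `v` (junk value `0` if `R` is empty). -/
noncomputable def distTo (H : SimpleGraph V) (R : Finset V) (v : V) : ℕ :=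
  sInf ((H.dist · v) '' R)

theorem distTo_le_dist (hu : u ∈ R) : distTo H R v ≤ H.dist u v :=
  Nat.sInf_le ⟨u, hu, rfl⟩

theorem distTo_le_length (hu : u ∈ R) (p : H.Walk u v) : distTo H R v ≤ p.length :=
  (distTo_le_dist hu).trans (dist_le p)

theorem exists_walk_length_eq_distTo (hH : H.Connected) (hR : R.Nonempty) (v : V) :
    ∃ u ∈ R, ∃ p : H.Walk u v, p.length = distTo H R v := by
  obtain ⟨u, hu, hdist⟩ := Nat.sInf_mem (hR.to_set.image (H.dist · v))
  obtain ⟨p, hp⟩ := hH.exists_walk_length_eq_dist u v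
  exact ⟨u, hu, p, hp.trans hdist⟩

theorem mem_of_distTo_eq_zero (hH : H.Connected) (hR : R.Nonempty) (h : distTo H R v = 0) :
    v ∈ R := by
  obtain ⟨u, hu, p, hp⟩ := exists_walk_length_eq_distTo hH hR v
  exact Walk.eq_of_length_eq_zero (hp.trans h) ▸ hu

theorem distTo_le_diam [Finite V] (hH : H.Connected) (hR : R.Nonempty) (v : V) :
    distTo H R v ≤ H.diam := by
  obtain ⟨u, hu⟩ := hR
  have : Nonempty V := ⟨u⟩
  exact (distTo_le_dist hu).trans (dist_le_diam (connected_iff_ediam_ne_top.1 hH))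

theorem Grows.distTo_le_sub_one (h : Grows H κ y R R') (hH : H.Connected) (hR : R.Nonempty)
    (v : V) : distTo H R' v ≤ distTo H R v - 1 := by
  obtain ⟨u, hu, p, hp⟩ := exists_walk_length_eq_distTo hH hR v
  rw [← hp]
  cases p with
  | nil => exact distTo_le_length (h.subset hu) .nil
  | cons huw p => exact distTo_le_length (h.mem_of_adj hu huw) p

end Growth

section Weights

variable {V : Type*} [DecidableEq V] {H : SimpleGraph V} {c : ℕ} {κ : V → Fin c} {x y : Fin c}
  {R R' : Finset V} {u v : V}

/-- The base `c / (c - 1)` of the weights. A node at distance `k` from the visited nodes is shielded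
by at most `c - 1` colours, at different positions of a shortest path; with this base the decay
of the weight beats their number. -/
noncomputable def weightBase (c : ℕ) : ℝ := 1 + ((c - 1 : ℕ) : ℝ)⁻¹

theorem one_le_weightBase (c : ℕ) : 1 ≤ weightBase c :=
  le_add_of_nonneg_right (by positivity)

theorem weightBase_pos (c : ℕ) : 0 < weightBase c := zero_lt_one.trans_le (one_le_weightBase c)

theorem sum_range_inv_weightBase_pow_le (c : ℕ) :
    ∑ i ∈ Finset.range (c - 1), (weightBase c)⁻¹ ^ (i + 1) ≤ 2 / 3 * ((c - 1 : ℕ) : ℝ) := by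
  have hpow : weightBase c ^ (c - 1) ≤ 3 :=
    Real.one_add_inv_pow_le_exp.trans (by linarith [Real.exp_one_lt_d9])
  have hbase := weightBase_pos c
  unfold weightBase at hpow hbase ⊢
  generalize c - 1 = n at hpow hbase ⊢
  rcases n.eq_zero_or_pos with rfl | hn
  · simp
  have : (0 : ℝ) < n := by exact_mod_cast hn
  set z := (1 + (n : ℝ)⁻¹)⁻¹ with hz
  have hzn : 1 / 3 ≤ z ^ n := by
    rw [hz, inv_pow, one_div]
    exact inv_anti₀ (pow_pos hbase _) hpow
  have hratio : z = n * (1 - z) := by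
    rw [hz]
    field_simp
    ring
  calc ∑ i ∈ Finset.range n, z ^ (i + 1) = z * ∑ i ∈ Finset.range n, z ^ i := by
        simp_rw [pow_succ', Finset.mul_sum]
    _ = n * ((1 - z) * ∑ i ∈ Finset.range n, z ^ i) := by
        rw [← mul_assoc, ← hratio]
    _ = n * (1 - z ^ n) := by rw [mul_neg_geom_sum]
    _ ≤ 2 / 3 * n := by nlinarith

theorem sum_inv_weightBase_pow_le {J : Finset ℕ} (hJ : J.card ≤ c - 1) :
    ∑ i ∈ J, (weightBase c)⁻¹ ^ (i + 1) ≤ 2 / 3 * ((c - 1 : ℕ) : ℝ) := by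
  have hinv : 0 < (weightBase c)⁻¹ := inv_pos.2 (weightBase_pos c)
  have hanti : Antitone fun i => (weightBase c)⁻¹ ^ (i + 1) := fun i i' hi =>
    pow_le_pow_of_le_one hinv.le (inv_le_one_of_one_le₀ (one_le_weightBase c)) (by omega)
  calc ∑ i ∈ J, (weightBase c)⁻¹ ^ (i + 1)
      ≤ ∑ i ∈ Finset.range J.card, (weightBase c)⁻¹ ^ (i + 1) := sum_le_sum_range_card hanti J
    _ ≤ ∑ i ∈ Finset.range (c - 1), (weightBase c)⁻¹ ^ (i + 1) :=
        Finset.sum_le_sum_of_subset_of_nonneg (Finset.range_mono hJ)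
          fun i _ _ => (pow_pos hinv _).le
    _ ≤ 2 / 3 * ((c - 1 : ℕ) : ℝ) := sum_range_inv_weightBase_pow_le c

/-- The weight of the node `v` when the nodes of `R` are known to be visited. -/
noncomputable def weight (c : ℕ) (H : SimpleGraph V) (R : Finset V) (v : V) : ℝ :=
  if v ∈ R then 0 else weightBase c ^ distTo H R v

theorem weight_of_mem (hv : v ∈ R) : weight c H R v = 0 := if_pos hv

theorem weight_of_notMem (hv : v ∉ R) : weight c H R v = weightBase c ^ distTo H R v := if_neg hv

theorem weight_nonneg (c : ℕ) (H : SimpleGraph V) (R : Finset V) (v : V) :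
    0 ≤ weight c H R v := by
  unfold weight
  have := weightBase_pos c
  positivity

theorem Grows.exists_weight_le (h : Grows H κ y R R') (hu : u ∈ R) (p : H.Walk u v)
    (hv : v ∉ R') : ∃ j, κ (p.getVert (j + 1)) = y ∧
      weight c H R' v ≤ weightBase c ^ p.length * (weightBase c)⁻¹ ^ (j + 1) := by
  obtain ⟨j, hj, hκ, hR'⟩ := h.exists_getVert hu p hv
  refine ⟨j, hκ, ?_⟩
  calc weight c H R' v = weightBase c ^ distTo H R' v := weight_of_notMem hv
    _ ≤ weightBase c ^ (p.length - (j + 1)) := by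
        refine pow_le_pow_right₀ (one_le_weightBase c) ?_
        simpa using distTo_le_length hR' (p.drop (j + 1))
    _ = weightBase c ^ p.length * (weightBase c)⁻¹ ^ (j + 1) := by
        rw [inv_pow, pow_sub₀ _ (weightBase_pos c).ne' hj]

theorem sum_weight_le (hH : H.Connected) (hR : R.Nonempty) {Rs : Fin c → Finset V}
    (h : ∀ y ≠ x, Grows H κ y R (Rs y)) (v : V) :
    ∑ y ∈ Finset.univ.erase x, weight c H (Rs y) v ≤
      2 / 3 * ((c - 1 : ℕ) : ℝ) * weight c H R v := by
  by_cases hv : v ∈ R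
  · rw [weight_of_mem hv, mul_zero]
    exact (Finset.sum_eq_zero fun y hy =>
      weight_of_mem ((h y (Finset.ne_of_mem_erase hy)).subset hv)).le
  obtain ⟨u, hu, p, hp⟩ := exists_walk_length_eq_distTo hH hR v
  set Y := {y ∈ Finset.univ.erase x | v ∉ Rs y}
  have hblock : ∀ y ∈ Y, ∃ j, κ (p.getVert (j + 1)) = y ∧
      weight c H (Rs y) v ≤ weightBase c ^ p.length * (weightBase c)⁻¹ ^ (j + 1) := by
    intro y hy
    obtain ⟨hyx, hvy⟩ := Finset.mem_filter.1 hy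
    exact (h y (Finset.ne_of_mem_erase hyx)).exists_weight_le hu p hvy
  choose! j hjκ hj using hblock
  have hinj : Set.InjOn j Y := fun y hy y' hy' hyy => by rw [← hjκ y hy, ← hjκ y' hy', hyy]
  have hcard : Y.card ≤ c - 1 := (Finset.card_filter_le _ _).trans_eq (by simp)
  calc ∑ y ∈ Finset.univ.erase x, weight c H (Rs y) v
      = ∑ y ∈ Y, weight c H (Rs y) v :=
        (Finset.sum_filter_of_ne (p := (v ∉ Rs ·)) fun y _ hy hvy => hy (weight_of_mem hvy)).symm
    _ ≤ ∑ y ∈ Y, weightBase c ^ p.length * (weightBase c)⁻¹ ^ (j y + 1) := Finset.sum_le_sum hj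
    _ = weightBase c ^ p.length * ∑ i ∈ Y.image j, (weightBase c)⁻¹ ^ (i + 1) := by
        rw [Finset.sum_image hinj, Finset.mul_sum]
    _ ≤ weightBase c ^ p.length * (2 / 3 * ((c - 1 : ℕ) : ℝ)) := by
        refine mul_le_mul_of_nonneg_left ?_ (pow_pos (weightBase_pos c) _).le
        exact sum_inv_weightBase_pow_le (Finset.card_image_le.trans hcard)
    _ = 2 / 3 * ((c - 1 : ℕ) : ℝ) * weight c H R v := by
        rw [weight_of_notMem hv, hp, mul_comm]

variable [Fintype V]

/-- The total weight of the nodes that are not known to be visited. -/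
noncomputable def totalWeight (c : ℕ) (H : SimpleGraph V) (R : Finset V) : ℝ :=
  ∑ v, weight c H R v

theorem totalWeight_nonneg (c : ℕ) (H : SimpleGraph V) (R : Finset V) : 0 ≤ totalWeight c H R :=
  Finset.sum_nonneg fun v _ => weight_nonneg c H R v

theorem one_le_totalWeight (c : ℕ) (H : SimpleGraph V) (hR : R ≠ Finset.univ) :
    1 ≤ totalWeight c H R := by
  obtain ⟨v, hv⟩ : ∃ v, v ∉ R := by simpa [Finset.eq_univ_iff_forall] using hR
  calc 1 ≤ weightBase c ^ distTo H R v := one_le_pow₀ (one_le_weightBase c)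
    _ = weight c H R v := (weight_of_notMem hv).symm
    _ ≤ totalWeight c H R :=
        Finset.single_le_sum (fun v _ => weight_nonneg c H R v) (Finset.mem_univ v)

theorem sum_totalWeight_le (hH : H.Connected) (hR : R.Nonempty) {Rs : Fin c → Finset V}
    (h : ∀ y ≠ x, Grows H κ y R (Rs y)) :
    ∑ y ∈ Finset.univ.erase x, totalWeight c H (Rs y) ≤
      2 / 3 * ((c - 1 : ℕ) : ℝ) * totalWeight c H R := by
  simp only [totalWeight]
  rw [Finset.sum_comm, Finset.mul_sum]
  exact Finset.sum_le_sum fun v _ => sum_weight_le hH hR h v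

theorem totalWeight_le (hH : H.Connected) (hR : R.Nonempty) :
    totalWeight c H R ≤ Fintype.card V * weightBase c ^ H.diam := by
  have hle : ∀ v ∈ Finset.univ, weight c H R v ≤ weightBase c ^ H.diam := by
    intro v _
    unfold weight
    split_ifs
    · exact (pow_pos (weightBase_pos c) _).le
    · exact pow_le_pow_right₀ (one_le_weightBase c) (distTo_le_diam hH hR v)
  exact (Finset.sum_le_card_nsmul _ _ _ hle).trans_eq (by simp)

theorem log_weightBase_le (hc : 2 ≤ c) : Real.log (weightBase c) ≤ 2 / c := by
  have hc2 : (2 : ℝ) ≤ c := by exact_mod_cast hc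
  calc Real.log (weightBase c) ≤ weightBase c - 1 := Real.log_le_sub_one_of_pos (weightBase_pos c)
    _ = 1 / ((c : ℝ) - 1) := by
        rw [weightBase, add_sub_cancel_left, Nat.cast_sub (by omega), Nat.cast_one, one_div]
    _ ≤ 2 / c := by
        rw [div_le_div_iff₀ (by linarith) (by linarith)]
        linarith

theorem log_totalWeight_le (hc : 2 ≤ c) (hH : H.Connected) (hR : R.Nonempty)
    (hne : R ≠ Finset.univ) :
    Real.log (totalWeight c H R) ≤ Real.log (Fintype.card V) + 2 * (H.diam / c) := by
  have hn : (Fintype.card V : ℝ) ≠ 0 := by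
    have : Nonempty V := ⟨hR.choose⟩
    exact_mod_cast Fintype.card_ne_zero
  have hpos : 0 < totalWeight c H R := zero_lt_one.trans_le (one_le_totalWeight c H hne)
  calc Real.log (totalWeight c H R)
      ≤ Real.log (Fintype.card V * weightBase c ^ H.diam) :=
        Real.log_le_log hpos (totalWeight_le hH hR)
    _ = Real.log (Fintype.card V) + H.diam * Real.log (weightBase c) := by
        rw [Real.log_mul hn (pow_pos (weightBase_pos c) _).ne', Real.log_pow]
    _ ≤ Real.log (Fintype.card V) + H.diam * (2 / c) := by
        gcongr
        exact log_weightBase_le hc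
    _ = Real.log (Fintype.card V) + 2 * (H.diam / c) := by ring

end Weights

section Supersolutions

variable {V : Type*} [Fintype V] [DecidableEq V] {H : SimpleGraph V} {c : ℕ} {κ : V → Fin c}
  {x : Fin c} {R R' : Finset V} {Rs : Fin c → Finset V}

/-- `Ψ R` bounds the expected number of traversals that remain when the nodes of `R`, all of
the current colour `x`, are known to be visited. The inequality `le` is the supersolution inequality
of this hitting time, multiplied by the number `c - 1` of possible next colours. -/
structure Supersolution (c : ℕ) (H : SimpleGraph V) (Ψ : Finset V → ℝ) : Prop where
  nonneg : ∀ R, 0 ≤ Ψ R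
  le : ∀ (κ : V → Fin c) (x : Fin c) (R : Finset V) (Rs : Fin c → Finset V), R.Nonempty →
    R ≠ Finset.univ → (∀ u ∈ R, κ u = x) → (∀ y ≠ x, Grows H κ y R (Rs y)) →
    ∑ y ∈ Finset.univ.erase x, (1 + Ψ (Rs y)) ≤ ((c - 1 : ℕ) : ℝ) * Ψ R

theorem sum_erase_const (x : Fin c) (a : ℝ) :
    ∑ _y ∈ Finset.univ.erase x, a = ((c - 1 : ℕ) : ℝ) * a := by
  simp

/-- The supersolution that measures the nodes not yet visited by the logarithm of their weight. -/
noncomputable def logPotential (c : ℕ) (H : SimpleGraph V) (R : Finset V) : ℝ :=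
  if R = Finset.univ then 0 else 3 * (1 + Real.log (totalWeight c H R))

theorem logPotential_nonneg (c : ℕ) (H : SimpleGraph V) (R : Finset V) :
    0 ≤ logPotential c H R := by
  unfold logPotential
  split_ifs with hR
  · exact le_rfl
  · linarith [Real.log_nonneg (one_le_totalWeight c H hR)]

theorem logPotential_le (hR : R ≠ Finset.univ) (R' : Finset V) :
    logPotential c H R' ≤
      3 * Real.log (totalWeight c H R) + 3 / totalWeight c H R * totalWeight c H R' := by
  have hF := one_le_totalWeight c H hR
  rw [logPotential, div_mul_eq_mul_div, mul_div_assoc]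
  split_ifs with hR'
  · have := totalWeight_nonneg c H R'
    have := Real.log_nonneg hF
    positivity
  · have hF' := one_le_totalWeight c H hR'
    have hlog := Real.log_le_sub_one_of_pos
      (div_pos (zero_lt_one.trans_le hF') (zero_lt_one.trans_le hF))
    rw [Real.log_div (by linarith) (by linarith)] at hlog
    linarith

theorem supersolution_logPotential (c : ℕ) (hH : H.Connected) :
    Supersolution c H (logPotential c H) where
  nonneg := logPotential_nonneg c H
  le κ x R Rs hR hne _ h := by
    set n : ℝ := ((c - 1 : ℕ) : ℝ)
    set F := totalWeight c H R
    have hF0 : 0 < F := zero_lt_one.trans_le (one_le_totalWeight c H hne)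
    calc ∑ y ∈ Finset.univ.erase x, (1 + logPotential c H (Rs y))
        ≤ ∑ y ∈ Finset.univ.erase x,
            (1 + (3 * Real.log F + 3 / F * totalWeight c H (Rs y))) :=
          Finset.sum_le_sum fun y _ => by gcongr; exact logPotential_le hne _
      _ = n * (1 + 3 * Real.log F) +
            3 / F * ∑ y ∈ Finset.univ.erase x, totalWeight c H (Rs y) := by
          rw [Finset.mul_sum, ← sum_erase_const x, ← Finset.sum_add_distrib]
          exact Finset.sum_congr rfl fun y _ => by ring
      _ ≤ n * (1 + 3 * Real.log F) + 3 / F * (2 / 3 * n * F) := by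
          gcongr
          exact sum_totalWeight_le hH hR h
      _ = n * logPotential c H R := by
          rw [logPotential, if_neg hne]
          field_simp
          ring

theorem sum_ite_ne_univ_le (hH : H.Connected) (hR : R.Nonempty) (hx : ∀ u ∈ R, κ u = x)
    (h : ∀ y ≠ x, Grows H κ y R (Rs y)) {a : ℝ} (ha : 0 ≤ a) :
    ∑ y ∈ Finset.univ.erase x, (if Rs y = Finset.univ then 0 else a) ≤
      (Fintype.card V - 1) * a := by
  obtain ⟨u, hu⟩ := hR
  have hxκ : x ∈ Finset.univ.image κ := Finset.mem_image.2 ⟨u, Finset.mem_univ u, hx u hu⟩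
  set Y := {y ∈ Finset.univ.erase x | Rs y ≠ Finset.univ}
  have hY : Y ⊆ (Finset.univ.image κ).erase x := by
    intro y hy
    obtain ⟨hyx, hRy⟩ := Finset.mem_filter.1 hy
    have hyx := Finset.ne_of_mem_erase hyx
    refine Finset.mem_erase.2 ⟨hyx, by_contra fun hyκ => hRy ?_⟩
    exact (h y hyx).eq_univ hH ⟨u, hu⟩ fun v hv =>
      hyκ (Finset.mem_image.2 ⟨v, Finset.mem_univ v, hv⟩)
  have hcard : Y.card + 1 ≤ Fintype.card V :=
    calc Y.card + 1 ≤ ((Finset.univ.image κ).erase x).card + 1 := by gcongr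
      _ = (Finset.univ.image κ).card := Finset.card_erase_add_one hxκ
      _ ≤ Fintype.card V := Finset.card_image_le
  calc ∑ y ∈ Finset.univ.erase x, (if Rs y = Finset.univ then 0 else a)
      = Y.card * a := by
        simp_rw [← ite_not (_ = _), Finset.sum_ite, Finset.sum_const_zero, add_zero,
          Finset.sum_const, nsmul_eq_mul, Y]
    _ ≤ (Fintype.card V - 1) * a := by
        gcongr
        exact le_sub_iff_add_le.2 (by exact_mod_cast hcard)

theorem supersolution_of_card_lt (hH : H.Connected) (hn : Fintype.card V < c) :
    Supersolution c H fun R =>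
      if R = Finset.univ then 0 else ((c - 1 : ℕ) : ℝ) / (c - Fintype.card V) where
  nonneg R := by
    have : (0 : ℝ) < c - Fintype.card V := sub_pos.2 (by exact_mod_cast hn)
    positivity
  le κ x R Rs hR hne hx h := by
    have hpos : (0 : ℝ) < c - Fintype.card V := sub_pos.2 (by exact_mod_cast hn)
    have hcast : ((c - 1 : ℕ) : ℝ) = c - 1 := by rw [Nat.cast_sub (by omega), Nat.cast_one]
    set a := ((c - 1 : ℕ) : ℝ) / (c - Fintype.card V) with ha
    have hmul : a * (c - Fintype.card V) = c - 1 := by rw [ha, div_mul_cancel₀ _ hpos.ne', hcast]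
    have hsum := sum_ite_ne_univ_le hH hR hx h (show 0 ≤ a by positivity)
    rw [if_neg hne, Finset.sum_add_distrib, sum_erase_const, hcast]
    linarith

end Supersolutions

end Pran

namespace Pran

open AgentAlgorithm PortGraph

section Ports

variable {d : ℕ}

theorem next_iterate (q : Fin d) (j : ℕ) : (next^[j] q : ℕ) = (q + j) % d := by
  induction j with
  | zero => simp [Nat.mod_eq_of_lt q.2]
  | succ j ih =>
    rw [Function.iterate_succ_apply']
    simp [next, ih, add_assoc]

theorem exists_next_iterate_eq (q p : Fin d) :
    ∃ i < d, next^[i + 1] q = p ∧ ∀ j < i, next^[j + 1] q ≠ p := by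
  have hex : ∃ i, i < d ∧ next^[i + 1] q = p := by
    refine ⟨(p + (d - 1 - q)) % d, Nat.mod_lt _ p.pos, Fin.ext ?_⟩
    rw [next_iterate, ((Nat.mod_modEq _ d).add_right 1).add_left q,
      show (q : ℕ) + (p + (d - 1 - q) + 1) = p + d by omega, Nat.add_mod_right,
      Nat.mod_eq_of_lt p.2]
  refine ⟨Nat.find hex, (Nat.find_spec hex).1, (Nat.find_spec hex).2, fun j hj hp => ?_⟩
  exact Nat.find_min hex hj ⟨hj.trans (Nat.find_spec hex).1, hp⟩

theorem exists_le_next_iterate_eq {q : Fin d} {i : ℕ} (h : next^[i + 1] q = q) (p : Fin d) :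
    ∃ j ≤ i, next^[j] q = p := by
  obtain ⟨j, -, hj, -⟩ := exists_next_iterate_eq q p
  refine ⟨(j + 1) % (i + 1), Nat.lt_succ_iff.1 (Nat.mod_lt _ i.succ_pos), ?_⟩
  rw [Function.IsPeriodicPt.iterate_mod_apply h, hj]

end Ports

variable {c : ℕ} {hc : 2 ≤ c} {G : PortGraph.{u}}

/-- The port through which an agent that circles around a node leaves it for good: the port of
the parent, or port `0` at a root, where the end of the traversal is then detected. -/
def exitPort {d : ℕ} (h : 0 < d) (w : Board c d) : Fin d := w.parent.getD ⟨0, h⟩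

/-- The counter after a migration in line 13 or 19: the loop test of line 5 comes next. -/
def Counter.IsLoop (k : Counter) : Prop := ∀ caller, k ≠ .line17 caller

theorem isLoop_line13 : Counter.line13.IsLoop := fun _ => nofun

theorem isLoop_line19 (caller : Caller) : (Counter.line19 caller).IsLoop := fun _ => nofun

/-- The whiteboards of all nodes of `G`. -/
abbrev Boards (c : ℕ) (G : PortGraph.{u}) : Type u := ∀ v : G.V, Board c (G.deg v)

/-- The configuration in which the agent stands at the node of the flag `a`, entered through its
port, with colour `x` and counter `k`. -/
def cfg (hc : 2 ≤ c) (a : G.Flag) (x : Fin c) (k : Counter) (b : Boards c G) :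
    Config (algorithm c hc) G :=
  ⟨a.1, a.2, (⟨x, k⟩ : Memory c), b⟩

section Step

variable {v : G.V} {q : Fin (G.deg v)} {x : Fin c} {k : Counter} {b : Boards c G}

theorem step_cfg : (cfg hc ⟨v, q⟩ x k b).step =
    (transition hc (G.deg v) q ⟨x, k⟩ (b v)).map fun r =>
      cfg hc (otherEnd ⟨v, r.1⟩) r.2.1.color r.2.1.counter (Function.update b v r.2.2) := rfl

theorem transition_of_isLoop {d : ℕ} {q : Fin d} {w : Board c d} (hk : k.IsLoop) :
    transition hc d q ⟨x, k⟩ w = loopTest hc d q ⟨x, k⟩ w := by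
  cases k with
  | line17 caller => exact absurd rfl (hk caller)
  | line13 => rfl
  | line19 _ => rfl

theorem step_bounce (caller : Caller) (hx : (b v).color = x) :
    (cfg hc ⟨v, q⟩ x (.line17 caller) b).step =
      PMF.pure (cfg hc (otherEnd ⟨v, q⟩) x (.line19 caller) b) := by
  rw [step_cfg, transition]
  simp only [hx, if_true, PMF.pure_map]
  rw [Function.update_eq_self]

theorem step_visit (hx : (b v).color ≠ x) :
    (cfg hc ⟨v, q⟩ x k b).step =
      PMF.pure (cfg hc (otherEnd ⟨v, next q⟩) x (.line17 .line9)
        (Function.update b v ⟨some q, x⟩)) := by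
  have htrans : transition hc (G.deg v) q ⟨x, k⟩ (b v) = loopTest hc (G.deg v) q ⟨x, k⟩ (b v) := by
    cases k <;> simp [transition, hx]
  rw [step_cfg, htrans, loopTest]
  simp only [hx, and_false, if_false, ne_eq, not_false_eq_true, if_true, PMF.pure_map]

theorem step_back (hk : k.IsLoop) (hx : (b v).color = x) (hp : (b v).parent = some (next q)) :
    (cfg hc ⟨v, q⟩ x k b).step =
      PMF.pure (cfg hc (otherEnd ⟨v, next q⟩) x .line13 (Function.update b v ⟨none, x⟩)) := by
  rw [step_cfg, transition_of_isLoop hk, loopTest]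
  simp only [hx, hp, reduceCtorEq, false_and, if_false, ne_eq, not_true_eq_false, if_true,
    PMF.pure_map]

theorem next_eq_zero_iff {d : ℕ} (q : Fin d) : next q = ⟨0, q.pos⟩ ↔ (q : ℕ) = d - 1 := by
  have hq := q.2
  rw [Fin.ext_iff]
  rcases (show (q : ℕ) + 1 < d ∨ (q : ℕ) + 1 = d by omega) with h | h
  · simp only [next, Nat.mod_eq_of_lt h]
    omega
  · simp only [next, h, Nat.mod_self, true_iff]
    omega

theorem step_forward (hk : k.IsLoop) (hx : (b v).color = x)
    (hq : next q ≠ exitPort q.pos (b v)) :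
    (cfg hc ⟨v, q⟩ x k b).step =
      PMF.pure (cfg hc (otherEnd ⟨v, next q⟩) x (.line17 .line15) b) := by
  have hroot : ¬((b v).parent = none ∧ (q : ℕ) = G.deg v - 1 ∧ (b v).color = x) := by
    rintro ⟨hp, hlast, -⟩
    exact hq (by rw [exitPort, hp, Option.getD_none, next_eq_zero_iff, hlast])
  have hparent : (b v).parent ≠ some (next q) := fun hp =>
    hq (by rw [exitPort, hp, Option.getD_some])
  rw [step_cfg, transition_of_isLoop hk, loopTest, if_neg hroot, if_neg (by simpa using hx),
    if_neg hparent, PMF.pure_map]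
  simp only [Function.update_eq_self]

/-- The agent stands at a node without parent and finds in line 5 that its traversal is over. -/
structure AtEnd (x : Fin c) (a : G.Flag) (k : Counter) (b : Boards c G) : Prop where
  isLoop : k.IsLoop
  color_eq : (b a.1).color = x
  parent_eq : (b a.1).parent = none
  next_eq : next a.2 = ⟨0, a.2.pos⟩

/-- The configuration after the first move of a traversal with colour `y` from the node of `a`. -/
def restart (hc : 2 ≤ c) (a : G.Flag) (y : Fin c) (b : Boards c G) : Config (algorithm c hc) G :=
  cfg hc (otherEnd ⟨a.1, ⟨0, a.2.pos⟩⟩) y (.line17 .line4) (Function.update b a.1 ⟨none, y⟩)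

theorem step_restart {a : G.Flag} (h : AtEnd x a k b) :
    (cfg hc a x k b).step =
      (PMF.uniformOfFinset (Finset.univ.erase x) (erase_nonempty hc x)).map fun y =>
        restart hc a y b := by
  obtain ⟨v, q⟩ := a
  rw [step_cfg, transition_of_isLoop h.isLoop, loopTest]
  simp only [h.color_eq, h.parent_eq, (next_eq_zero_iff q).1 h.next_eq, and_self, if_true,
    PMF.map_comp]
  rfl

end Step

section Paint

variable {x : Fin c} {A : Finset G.V} {b : Boards c G} {v : G.V}

/-- The boards after a traversal with colour `x` that entered the nodes of `A` and left them. -/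
def paint (x : Fin c) (A : Finset G.V) (b : Boards c G) : Boards c G :=
  fun v => if v ∈ A then ⟨none, x⟩ else b v

theorem paint_of_mem (h : v ∈ A) : paint x A b v = ⟨none, x⟩ := if_pos h

theorem paint_of_notMem (h : v ∉ A) : paint x A b v = b v := if_neg h

theorem paint_paint (x : Fin c) (A A' : Finset G.V) (b : Boards c G) :
    paint x A' (paint x A b) = paint x (A ∪ A') b := by
  funext v
  by_cases h : v ∈ A <;> by_cases h' : v ∈ A' <;> simp [paint, h, h']

theorem paint_empty (x : Fin c) (b : Boards c G) : paint x ∅ b = b := by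
  funext v
  simp [paint]

theorem update_paint (x : Fin c) (A : Finset G.V) (b : Boards c G) (v : G.V) :
    Function.update (paint x A b) v ⟨none, x⟩ = paint x (insert v A) b := by
  funext w
  by_cases h : w = v
  · subst h; simp [paint]
  · simp [paint, h]

theorem paint_insert_update (x : Fin c) (A : Finset G.V) (b : Boards c G) (v : G.V)
    (w : Board c (G.deg v)) :
    paint x (insert v A) (Function.update b v w) = paint x (insert v A) b := by
  funext u
  by_cases h : u = v
  · subst h; simp [paint]
  · simp [paint, h]

theorem color_paint_eq_iff : (paint x A b v).color = x ↔ v ∈ A ∨ (b v).color = x := by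
  by_cases hv : v ∈ A <;> simp [paint, hv]

end Paint

section Cost

/-- The bound for the number of moves charged to the nodes of `A`. -/
def cost (A : Finset G.V) : ℕ := ∑ v ∈ A, (2 * G.deg v + 1)

theorem cost_mono {A A' : Finset G.V} (h : A ⊆ A') : cost A ≤ cost A' :=
  Finset.sum_le_sum_of_subset h

theorem cost_insert {A : Finset G.V} {v : G.V} (hv : v ∉ A) :
    cost (insert v A) = 2 * G.deg v + 1 + cost A :=
  Finset.sum_insert hv

theorem cost_le [Nontrivial G.V] (A : Finset G.V) : cost A ≤ 6 * G.numEdges := by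
  calc cost A ≤ cost (Finset.univ : Finset G.V) := cost_mono (Finset.subset_univ A)
    _ = 2 * (2 * G.numEdges) + G.numNodes := by
        rw [cost, Finset.sum_add_distrib, ← Finset.mul_sum,
          G.graph.sum_degrees_eq_twice_card_edges]
        simp
    _ ≤ 6 * G.numEdges := by linarith [G.card_le_two_mul_numEdges]

end Cost

section Spans

variable {V : Type*} {H : SimpleGraph V} {v w : V} {A B : Finset V}

/-- Every node of `A` is reached from `v` by a walk whose nodes after `v` belong to `A`; the node
`v` itself need not belong to `A`. -/
def Spans (H : SimpleGraph V) (v : V) (A : Finset V) : Prop :=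
  ∀ u ∈ A, Relation.ReflTransGen (fun a w => H.Adj a w ∧ w ∈ A) v u

namespace Spans

theorem empty : Spans H v ∅ := nofun

theorem subset (h : Spans H v A) (hv : v ∈ B)
    (hB : ∀ u ∈ B, ∀ w ∈ A, H.Adj u w → w ∈ B) : A ⊆ B := by
  intro u hu
  have hvu := h u hu
  clear hu
  induction hvu with
  | refl => exact hv
  | tail _ hw ih => exact hB _ ih _ hw.2 hw.1

theorem reachable_of_subset (h : Spans H v A) (hAB : A ⊆ B) (hu : u ∈ A) :
    Relation.ReflTransGen (fun w w' => H.Adj w w' ∧ w' ∈ B) v u :=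
  Relation.ReflTransGen.mono (fun _ _ h => h.imp_right (@hAB _)) _ _ (h u hu)

theorem union [DecidableEq V] (hA : Spans H v A) (hB : Spans H v B) : Spans H v (A ∪ B) := by
  intro u hu
  rcases Finset.mem_union.1 hu with hu | hu
  · exact hA.reachable_of_subset Finset.subset_union_left hu
  · exact hB.reachable_of_subset Finset.subset_union_right hu

theorem insert [DecidableEq V] (h : Spans H v A) : Spans H v (insert v A) := by
  intro u hu
  rcases Finset.mem_insert.1 hu with rfl | hu
  · exact .refl
  · exact h.reachable_of_subset (Finset.subset_insert v A) hu

theorem of_adj (h : Spans H w A) (hvw : H.Adj v w) (hw : w ∈ A) : Spans H v A :=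
  fun u hu => (h u hu).head ⟨hvw, hw⟩

end Spans

end Spans

section Sweep

variable {x : Fin c} {b : Boards c G} {v w : G.V} {q : Fin (G.deg v)} {k : Counter}
  {A A' W W' : Finset G.V} {γ : Config (algorithm c hc) G}

/-- After a part of a traversal with colour `x` that entered the nodes of `A`, from the boards
`b` on, the node `w` is visited and has the colour `x`. -/
def Met (x : Fin c) (b : Boards c G) (A W : Finset G.V) (w : G.V) : Prop :=
  w ∈ W ∧ (w ∈ A ∨ (b w).color = x)

theorem Met.union (h : Met x b A W w) (hW : W ⊆ W') : Met x b (A ∪ A') W' w :=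
  ⟨hW h.1, h.2.imp_left (Finset.mem_union_left A')⟩

theorem Met.of_paint (h : Met x (paint x A b) A' W w) : Met x b (A ∪ A') W w := by
  refine ⟨h.1, ?_⟩
  rw [Finset.mem_union, or_comm (a := w ∈ A), or_assoc, ← color_paint_eq_iff]
  exact h.2

/-- The set `A` of the nodes that a part of a traversal with colour `x` enters, below the node
`v`; the boards before it are `b`, and `W` is the set of the nodes visited afterwards. -/
structure Swept (x : Fin c) (b : Boards c G) (v : G.V) (A W : Finset G.V) : Prop where
  fresh : ∀ u ∈ A, (b u).color ≠ x
  subset : A ⊆ W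
  met : ∀ u ∈ A, ∀ w, G.graph.Adj u w → Met x b A W w
  spans : Spans G.graph v A

namespace Swept

theorem empty : Swept x b v ∅ W := ⟨nofun, Finset.empty_subset W, nofun, .empty⟩

theorem notMem (h : Swept x b v A W) (hw : (b w).color = x) : w ∉ A := fun hA => h.fresh w hA hw

theorem union (h : Swept x b v A W) (h' : Swept x (paint x A b) v A' W') (hW : W ⊆ W') :
    Swept x b v (A ∪ A') W' where
  fresh u hu hx := by
    rcases Finset.mem_union.1 hu with hu | hu
    · exact h.fresh u hu hx
    · exact h'.fresh u hu (color_paint_eq_iff.2 (.inr hx))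
  subset := Finset.union_subset (h.subset.trans hW) h'.subset
  met u hu w huw := by
    rcases Finset.mem_union.1 hu with hu | hu
    · exact (h.met u hu w huw).union hW
    · exact (h'.met u hu w huw).of_paint
  spans := h.spans.union h'.spans

theorem cost_union (h' : Swept x (paint x A b) v A' W') : cost (A ∪ A') = cost A + cost A' :=
  Finset.sum_union <| Finset.disjoint_left.2 fun u hu hu' =>
    h'.fresh u hu' (color_paint_eq_iff.2 (.inl hu))

variable {o : Option (Fin (G.deg v))}

theorem color_ne_of_mem_insert (h : Swept x (Function.update b v ⟨o, x⟩) v A W)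
    (hx : (b v).color ≠ x) {u : G.V} (hu : u ∈ insert v A) : (b u).color ≠ x := by
  rcases eq_or_ne u v with rfl | huv
  · exact hx
  · simpa [huv] using h.fresh u (Finset.mem_of_mem_insert_of_ne hu huv)

theorem insert (h : Swept x (Function.update b v ⟨o, x⟩) v A W) (hx : (b v).color ≠ x)
    (hv : v ∈ W) (hmet : ∀ w, G.graph.Adj v w → Met x (Function.update b v ⟨o, x⟩) A W w) :
    Swept x b v (insert v A) W where
  fresh _ := h.color_ne_of_mem_insert hx
  subset := Finset.insert_subset hv h.subset
  met u hu w huw := by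
    have hw : Met x (Function.update b v ⟨o, x⟩) A W w := by
      rcases Finset.mem_insert.1 hu with rfl | hu
      · exact hmet w huw
      · exact h.met u hu w huw
    refine ⟨hw.1, ?_⟩
    rcases eq_or_ne w v with rfl | hwv
    · exact .inl (Finset.mem_insert_self w A)
    · exact hw.2.imp Finset.mem_insert_of_mem fun h => by rwa [Function.update_of_ne hwv] at h
  spans := h.spans.insert

theorem of_adj (h : Swept x b w A W) (hvw : G.graph.Adj v w) (hw : w ∈ A) : Swept x b v A W :=
  { h with spans := h.spans.of_adj hvw hw }

end Swept

/-- From the configuration `γ` with boards `b` the agent comes to the port `q` of `v`, to test the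
loop condition there, after at most `e` moves in addition to the cost of the nodes that it enters
with colour `x`; then the neighbours behind the ports of `P` have been met. -/
def Sweeps (γ : Config (algorithm c hc) G) (W : Finset G.V) (x : Fin c) (b : Boards c G) (v : G.V)
    (q : Fin (G.deg v)) (e : ℕ) (P : Set (Fin (G.deg v))) : Prop :=
  ∃ t A k W', k.IsLoop ∧ Run t γ W (cfg hc ⟨v, q⟩ x k (paint x A b)) W' ∧ Swept x b v A W' ∧
    (∀ p ∈ P, Met x b A W' (G.nbr v p)) ∧ t ≤ e + cost A

namespace Sweeps

variable {q' : Fin (G.deg v)} {e e' : ℕ} {P P' : Set (Fin (G.deg v))}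

theorem refl (hk : k.IsLoop) : Sweeps (cfg hc ⟨v, q⟩ x k b) W x b v q 0 ∅ :=
  ⟨0, ∅, k, W, hk, by rw [paint_empty]; exact .refl _ _, .empty, nofun, Nat.zero_le _⟩

theorem mono (h : Sweeps γ W x b v q e P) (hP : P' ⊆ P) : Sweeps γ W x b v q e P' :=
  let ⟨t, A, k, W', hk, hrun, hA, hmet, ht⟩ := h
  ⟨t, A, k, W', hk, hrun, hA, fun p hp => hmet p (hP hp), ht⟩

theorem step {γ' : Config (algorithm c hc) G} (hs : γ.step = PMF.pure γ')
    (h : Sweeps γ' (insert γ'.loc W) x b v q e P) : Sweeps γ W x b v q (e + 1) P :=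
  let ⟨t, A, k, W', hk, hrun, hA, hmet, ht⟩ := h
  ⟨t + 1, A, k, W', hk, .step hs hrun, hA, hmet, by omega⟩

theorem trans (hx : (b v).color = x) (h : Sweeps γ W x b v q e P)
    (h' : ∀ A k W', k.IsLoop → paint x A b v = b v →
      Sweeps (cfg hc ⟨v, q⟩ x k (paint x A b)) W' x (paint x A b) v q' e' P') :
    Sweeps γ W x b v q' (e + e') (P ∪ P') := by
  obtain ⟨t, A, k, W₁, hk, hrun, hA, hmet, ht⟩ := h
  obtain ⟨t', A', k', W', hk', hrun', hA', hmet', ht'⟩ :=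
    h' A k W₁ hk (paint_of_notMem (hA.notMem hx))
  have hW := hrun'.visited_subset
  refine ⟨t + t', A ∪ A', k', W', hk', ?_, hA.union hA' hW, ?_, ?_⟩
  · rw [← paint_paint]
    exact hrun.trans hrun'
  · rintro p (hp | hp)
    · exact (hmet p hp).union hW
    · exact (hmet' p hp).of_paint
  · rw [hA'.cost_union]
    omega

end Sweeps

/-- When the agent leaves `v` through the port `q` in a call of `GoForward`, with colour `x` and
boards `b`, it comes back through `q`. -/
def Probes (hc : 2 ≤ c) (x : Fin c) (b : Boards c G) (v : G.V) (q : Fin (G.deg v)) : Prop :=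
  ∀ caller W, G.nbr v q ∈ W →
    Sweeps (cfg hc (otherEnd ⟨v, q⟩) x (.line17 caller) b) W x b v q 1 {q}

theorem sweeps_rotate (hx : (b v).color = x) (hprobe : ∀ A q, Probes hc x (paint x A b) v q)
    (hk : k.IsLoop) (i : ℕ) (hq : ∀ j < i, next^[j + 1] q ≠ exitPort q.pos (b v)) :
    Sweeps (cfg hc ⟨v, q⟩ x k b) W x b v (next^[i] q) (2 * i)
      {p | ∃ j < i, next^[j + 1] q = p} := by
  induction i with
  | zero => exact (Sweeps.refl hk).mono fun p ⟨j, hj, _⟩ => absurd hj j.not_lt_zero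
  | succ i ih =>
    refine ((ih fun j hj => hq j (hj.trans i.lt_succ_self)).trans hx (e' := 2)
      (q' := next^[i + 1] q) (P' := {next^[i + 1] q}) fun A k' W' hk' hv => ?_).mono ?_
    · have hexit := hq i i.lt_succ_self
      rw [Function.iterate_succ_apply'] at hexit ⊢
      exact .step (step_forward hk' (by rwa [hv]) (by rwa [hv]))
        (hprobe A _ _ _ (Finset.mem_insert_self _ _))
    · rintro p ⟨j, hj, rfl⟩
      rcases Nat.lt_succ_iff_lt_or_eq.1 hj with hj | rfl
      · exact .inl ⟨j, hj, rfl⟩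
      · exact .inr rfl

theorem sweeps_circle (hx : (b v).color = x) (hprobe : ∀ A q, Probes hc x (paint x A b) v q)
    (i : ℕ) (hq : ∀ j < i, next^[j + 1] q ≠ exitPort q.pos (b v)) (caller : Caller)
    (hW : G.nbr v q ∈ W) :
    Sweeps (cfg hc (otherEnd ⟨v, q⟩) x (.line17 caller) b) W x b v (next^[i] q) (1 + 2 * i)
      {p | ∃ j ≤ i, next^[j] q = p} := by
  have hprobe' : Probes hc x b v q := by simpa only [paint_empty] using hprobe ∅ q
  refine ((hprobe' caller W hW).trans hx fun A k W' hk hv =>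
    sweeps_rotate (by rwa [hv]) (fun A' p => ?_) hk i (by rwa [hv])).mono ?_
  · rw [paint_paint]
    exact hprobe _ p
  · rintro p ⟨_ | j, hj, rfl⟩
    · exact .inl rfl
    · exact .inr ⟨j, hj, rfl⟩

theorem visit_run (hx : (b v).color ≠ x)
    (hprobe : ∀ A p, Probes hc x (paint x A (Function.update b v ⟨some q, x⟩)) v p)
    (k : Counter) (W : Finset G.V) :
    ∃ t A W', Run t (cfg hc ⟨v, q⟩ x k b) W
        (cfg hc (otherEnd ⟨v, q⟩) x .line13 (paint x (insert v A) b)) W' ∧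
      Swept x (Function.update b v ⟨some q, x⟩) v A W' ∧
      (∀ p ≠ q, Met x (Function.update b v ⟨some q, x⟩) A W' (G.nbr v p)) ∧
      t ≤ cost (insert v A) := by
  set b' : Boards c G := Function.update b v ⟨some q, x⟩
  have hv : b' v = ⟨some q, x⟩ := Function.update_self ..
  have hx' : (b' v).color = x := by rw [hv]
  obtain ⟨i, hi, hiq, hlt⟩ := exists_next_iterate_eq (next q) q
  obtain ⟨t, A, k', W', hk', hrun, hA, hmet, ht⟩ :=
    sweeps_circle hx' hprobe i (by rwa [hv]) .line9 (Finset.mem_insert_self _ W)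
  have hvA : v ∉ A := hA.notMem hx'
  have hpaint : paint x A b' v = ⟨some q, x⟩ := by rw [paint_of_notMem hvA, hv]
  rw [Function.iterate_succ_apply'] at hiq
  have hback := step_back (hc := hc) (b := paint x A b') hk' (by rw [hpaint]) (by rw [hpaint, hiq])
  rw [hiq, update_paint, paint_insert_update] at hback
  refine ⟨_, A, _, (Run.step (step_visit hx) hrun).trans (Run.single hback),
    { hA with
      subset := hA.subset.trans (Finset.subset_insert _ _)
      met := fun u hu w huw => (hA.met u hu w huw).imp_left Finset.mem_insert_of_mem },
    fun p hp => ?_, ?_⟩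
  · obtain ⟨_ | j, hj, rfl⟩ := exists_le_next_iterate_eq (i := i + 1) (q := q)
      (by rwa [Function.iterate_succ_apply, Function.iterate_succ_apply']) p
    · exact absurd rfl hp
    · exact (hmet _ ⟨j, Nat.le_of_succ_le_succ hj, rfl⟩).imp_left Finset.mem_insert_of_mem
  · rw [cost_insert hvA]
    omega

/-- The number of nodes whose colour is not `x`. -/
def freshCount (x : Fin c) (b : Boards c G) : ℕ :=
  (Finset.univ.filter fun v : G.V => (b v).color ≠ x).card

theorem freshCount_paint_update_lt (hv : (b v).color ≠ x) (o : Option (Fin (G.deg v))) :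
    freshCount x (paint x A (Function.update b v ⟨o, x⟩)) < freshCount x b := by
  refine Finset.card_lt_card ⟨fun u => ?_, fun h => ?_⟩
  · rcases eq_or_ne u v with rfl | huv
    · simp [hv]
    · simp [color_paint_eq_iff, huv]
  · simpa [color_paint_eq_iff] using h (by simpa using hv : v ∈ Finset.univ.filter _)

theorem probes (hx : (b v).color = x) (q : Fin (G.deg v)) : Probes hc x b v q := by
  induction hN : freshCount x b using Nat.strong_induction_on generalizing b v q with
  | _ N ih =>
    intro caller W hW
    have hback : otherEnd (otherEnd (⟨v, q⟩ : G.Flag)) = ⟨v, q⟩ := otherEnd_otherEnd _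
    rw [show otherEnd (⟨v, q⟩ : G.Flag) = ⟨G.nbr v q, G.backPort v q⟩ from rfl] at hback ⊢
    by_cases hw : (b (G.nbr v q)).color = x
    · have hs := step_bounce (hc := hc) (q := G.backPort v q) caller hw
      rw [hback] at hs
      exact ⟨1, ∅, _, _, isLoop_line19 caller, by rw [paint_empty]; exact .single hs, .empty,
        fun p hp => ⟨Finset.mem_insert_of_mem (hp ▸ hW), .inr (hp ▸ hw)⟩, by omega⟩
    · obtain ⟨t, A, W', hrun, hA, hmet, ht⟩ := visit_run (hc := hc) (q := G.backPort v q) hw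
        (fun A p => ih _ (hN ▸ freshCount_paint_update_lt hw _)
          (color_paint_eq_iff.2 (.inr (by simp))) p rfl) (.line17 caller) W
      have hwW := hrun.visited_subset hW
      have hvW := hrun.loc_mem hW
      rw [hback] at hrun hvW
      have hA' : Swept x b (G.nbr v q) (insert (G.nbr v q) A) W' := by
        refine hA.insert hw hwW fun z hz => ?_
        obtain ⟨p, rfl⟩ := exists_nbr_eq hz
        by_cases hp : p = G.backPort v q
        · rw [hp, show G.nbr (G.nbr v q) (G.backPort v q) = v from congrArg Sigma.fst hback]
          exact ⟨hvW, .inr (by rwa [Function.update_of_ne (G.adj_nbr v q).ne])⟩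
        · exact hmet p hp
      have hmem := Finset.mem_insert_self (G.nbr v q) A
      exact ⟨t, _, _, W', isLoop_line13, hrun, hA'.of_adj (G.adj_nbr v q) hmem,
        fun p hp => ⟨hp ▸ hwW, .inl (hp ▸ hmem)⟩, by omega⟩

theorem traversal_run {a : G.Flag} {y : Fin c} (hy : (b a.1).color ≠ y) (ha : a.1 ∈ W)
    (hW : G.nbr a.1 ⟨0, a.2.pos⟩ ∈ W) :
    ∃ t A q k W', Run t (restart hc a y b) W (cfg hc ⟨a.1, q⟩ y k (paint y A b)) W' ∧
      AtEnd y ⟨a.1, q⟩ k (paint y A b) ∧ a.1 ∈ A ∧ Swept y b a.1 A W' ∧ t + 1 ≤ cost A := by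
  obtain ⟨r, p⟩ := a
  set b' : Boards c G := Function.update b r ⟨none, y⟩ with hb'
  have hr : b' r = ⟨none, y⟩ := Function.update_self ..
  have hy' : (b' r).color = y := by rw [hr]
  set z : Fin (G.deg r) := ⟨0, p.pos⟩
  obtain ⟨i, hi, hiz, hlt⟩ := exists_next_iterate_eq z z
  obtain ⟨t, A, k, W', hk, hrun, hA, hmet, ht⟩ := sweeps_circle (hc := hc) hy'
    (fun A p => probes (color_paint_eq_iff.2 (.inr hy')) p) i (by rwa [hr]) .line4 hW
  have hrA : r ∉ A := hA.notMem hy'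
  have hpaint : paint y A b' = paint y (insert r A) b := by
    rw [← paint_insert_update y A b r ⟨none, y⟩, ← update_paint, ← hb']
    exact (Function.update_eq_self_iff.2 (by rw [paint_of_notMem hrA, hr])).symm
  have hroot := Finset.mem_insert_self r A
  rw [hpaint] at hrun
  refine ⟨t, insert r A, next^[i] z, k, W', hrun, ?_, hroot, hA.insert hy ?_ ?_, ?_⟩
  · refine ⟨hk, ?_, ?_, ?_⟩
    · simp only [paint_of_mem hroot]
    · simp only [paint_of_mem hroot]
    · rwa [Function.iterate_succ_apply'] at hiz
  · exact hrun.visited_subset ha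
  · intro w hw
    obtain ⟨p, rfl⟩ := exists_nbr_eq hw
    exact hmet p (exists_le_next_iterate_eq hiz p)
  · rw [cost_insert hrA]
    omega

end Sweep

section Startup

variable {x : Fin c} {b : Boards c G} {v : G.V} {q : Fin (G.deg v)} {k : Counter}
  {A W : Finset G.V} {N : ℕ} {γ γ' : Config (algorithm c hc) G}

/-- The number of times that a node can still be left for its parent during a traversal with
colour `x`. -/
def rank {d : ℕ} (x : Fin c) (w : Board c d) : ℕ :=
  if w.color ≠ x then 2 else if w.parent = none then 0 else 1

theorem rank_pos_of_color_ne {d : ℕ} {w : Board c d} (h : w.color ≠ x) : 0 < rank x w := by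
  simp [rank, h]

theorem rank_le_two {d : ℕ} (w : Board c d) : rank x w ≤ 2 := by
  rw [rank]; split_ifs <;> omega

/-- A bound for the number of moves until the agent, with colour `x`, leaves no more nodes for
their parents. -/
def potential (x : Fin c) (b : Boards c G) : ℕ := ∑ v, (2 * G.deg v + 1) * rank x (b v)

theorem potential_le : potential x b ≤ 2 * cost (Finset.univ : Finset G.V) := by
  rw [potential, cost, Finset.mul_sum]
  exact Finset.sum_le_sum fun v _ => by nlinarith [rank_le_two (x := x) (b v)]

theorem potential_paint_add_cost_le (h : ∀ v ∈ A, 0 < rank x (b v)) :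
    potential x (paint x A b) + cost A ≤ potential x b := by
  have hcost : cost A = ∑ v, if v ∈ A then 2 * G.deg v + 1 else 0 := by
    rw [cost, Finset.sum_ite_mem, Finset.univ_inter]
  rw [potential, potential, hcost, ← Finset.sum_add_distrib]
  refine Finset.sum_le_sum fun v _ => ?_
  by_cases hv : v ∈ A
  · rw [paint_of_mem hv, if_pos hv]
    simp only [rank, ne_eq, not_true_eq_false, if_false, if_true, mul_zero, zero_add]
    exact Nat.le_mul_of_pos_right _ (h v hv)
  · rw [paint_of_notMem hv, if_neg hv, add_zero]

/-- From `γ` the agent ends its traversal after at most `N` moves, none of them random. -/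
def EndsWithin (γ : Config (algorithm c hc) G) (W : Finset G.V) (N : ℕ) : Prop :=
  ∃ t ≤ N, ∃ x a k b W', AtEnd x a k b ∧ Run t γ W (cfg hc a x k b) W'

theorem EndsWithin.of_run {t : ℕ} {W' : Finset G.V} (hrun : Run t γ W γ' W')
    (h : EndsWithin γ' W' N) : EndsWithin γ W (t + N) :=
  let ⟨_, ht, x, a, k, b, W', hend, hrun'⟩ := h
  ⟨_, Nat.add_le_add_left ht t, x, a, k, b, W', hend, hrun.trans hrun'⟩

theorem EndsWithin.mono {M : ℕ} (h : EndsWithin γ W N) (hNM : N ≤ M) : EndsWithin γ W M :=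
  let ⟨t, ht, h⟩ := h
  ⟨t, ht.trans hNM, h⟩

/-- The agent, with colour `x`, leaves a node for its parent after entering some other nodes; all
these nodes form the set `A`. -/
def Climbs (γ : Config (algorithm c hc) G) (W : Finset G.V) (x : Fin c) (b : Boards c G) : Prop :=
  ∃ t A a W', Run t γ W (cfg hc a x .line13 (paint x A b)) W' ∧ A.Nonempty ∧
    (∀ u ∈ A, 0 < rank x (b u)) ∧ t ≤ cost A

theorem climbs_of_color_ne (hx : (b v).color ≠ x) : Climbs (cfg hc ⟨v, q⟩ x k b) W x b :=
  let ⟨t, A, W', hrun, hA, _, ht⟩ :=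
    visit_run hx (fun _ p => probes (color_paint_eq_iff.2 (.inr (by simp))) p) k W
  ⟨t, insert v A, _, W', hrun, Finset.insert_nonempty v A,
    fun _ hu => rank_pos_of_color_ne (hA.color_ne_of_mem_insert hx hu), ht⟩

theorem climbs_or_endsWithin (hk : k.IsLoop ∨ (b v).color ≠ x) :
    Climbs (cfg hc ⟨v, q⟩ x k b) W x b ∨
      EndsWithin (cfg hc ⟨v, q⟩ x k b) W (cost (Finset.univ : Finset G.V)) := by
  by_cases hx : (b v).color = x
  swap
  · exact .inl (climbs_of_color_ne hx)
  obtain ⟨i, hi, hexit, hlt⟩ := exists_next_iterate_eq q (exitPort q.pos (b v))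
  obtain ⟨t, A, k', W', hk', hrun, hA, -, ht⟩ := sweeps_rotate (W := W) hx
    (fun A p => probes (hc := hc) (color_paint_eq_iff.2 (.inr hx)) p)
    (hk.resolve_right (not_not.2 hx)) i hlt
  have hvA := hA.notMem hx
  have hv : paint x A b v = b v := paint_of_notMem hvA
  have hcost : t + 1 ≤ cost (insert v A) := by
    rw [cost_insert hvA]
    omega
  rw [Function.iterate_succ_apply'] at hexit
  rcases hp : (b v).parent with _ | p <;> rw [exitPort, hp] at hexit
  · refine .inr ⟨t, (Nat.le_of_succ_le hcost).trans (cost_mono (Finset.subset_univ _)), x, _, k', _,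
      W', ⟨hk', ?_, ?_, hexit⟩, hrun⟩ <;> rwa [hv]
  · have hs := step_back (hc := hc) (x := x) (b := paint x A b) hk' (by rwa [hv])
      (by rw [hv, hp, hexit]; rfl)
    rw [update_paint] at hs
    refine .inl ⟨t + 1, insert v A, _, _, hrun.trans (.single hs), Finset.insert_nonempty v A,
      fun u hu => ?_, hcost⟩
    rcases Finset.mem_insert.1 hu with rfl | hu
    · simp [rank, hx, hp]
    · exact rank_pos_of_color_ne (hA.fresh u hu)

theorem endsWithin_of_isLoop_or_color_ne (hk : k.IsLoop ∨ (b v).color ≠ x) :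
    EndsWithin (cfg hc ⟨v, q⟩ x k b) W (potential x b + cost (Finset.univ : Finset G.V)) := by
  induction hN : potential x b using Nat.strong_induction_on generalizing v q k b W with
  | _ N ih =>
    rcases climbs_or_endsWithin (hc := hc) (q := q) (W := W) hk with hclimb | hend
    · obtain ⟨t, A, ⟨v', q'⟩, W', hrun, hne, hrank, ht⟩ := hclimb
      have hpot := potential_paint_add_cost_le hrank
      have hpos : 0 < cost A := Finset.sum_pos (fun _ _ => Nat.succ_pos _) hne
      exact (EndsWithin.of_run hrun (ih _ (by omega) (.inl isLoop_line13) rfl)).mono (by omega)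
    · exact hend.mono (Nat.le_add_left _ _)

theorem endsWithin (γ : Config (algorithm c hc) G) (W : Finset G.V) :
    EndsWithin γ W (19 * G.numEdges) := by
  obtain ⟨v, q, ⟨x, k⟩, b⟩ := γ
  have := nontrivial_of_port q
  have hcost := cost_le (Finset.univ : Finset G.V)
  have hm := G.numEdges_pos
  have hpot := potential_le (x := x) (b := b)
  by_cases hk : k.IsLoop ∨ Board.color (b v) ≠ x
  · exact (endsWithin_of_isLoop_or_color_ne (hc := hc) (q := q) hk).mono (by omega)
  · simp only [Counter.IsLoop, ne_eq, not_or, not_forall, not_not] at hk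
    obtain ⟨⟨caller, rfl⟩, hx⟩ := hk
    exact (EndsWithin.of_run (.single (step_bounce (hc := hc) (q := q) caller hx))
      (endsWithin_of_isLoop_or_color_ne (.inl (isLoop_line19 caller)))).mono (by omega)

end Startup

end Pran

namespace Pran

open AgentAlgorithm PortGraph MeasureTheory

variable {c : ℕ} {hc : 2 ≤ c} {G : PortGraph.{u}}

section Averaging

variable {x : Fin c} {a : G.Flag} {k : Counter} {b : Boards c G}

theorem lintegral_step_of_atEnd (h : AtEnd x a k b) (F : Config (algorithm c hc) G → ℝ≥0∞) :
    ∫⁻ γ, F γ ∂(cfg hc a x k b).step.toMeasure =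
      ((c - 1 : ℕ) : ℝ≥0∞)⁻¹ * ∑ y ∈ Finset.univ.erase x, F (restart hc a y b) := by
  rw [step_restart h, lintegral_map_uniformOfFinset, Finset.card_erase_of_mem (Finset.mem_univ x),
    Finset.card_univ, Fintype.card_fin]

end Averaging

section Grown

variable {x y : Fin c} {a : G.Flag} {k : Counter} {b : Boards c G} {r : G.V}
  {A R W : Finset G.V}

/-- The nodes of `A` and their neighbours. -/
def closedNeighborhood (A : Finset G.V) : Finset G.V :=
  A ∪ A.biUnion fun u => G.graph.neighborFinset u

theorem mem_closedNeighborhood_of_adj {u w : G.V} (hu : u ∈ A) (huw : G.graph.Adj u w) :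
    w ∈ closedNeighborhood A :=
  Finset.mem_union_right _ (Finset.mem_biUnion.2 ⟨u, hu, (G.graph.mem_neighborFinset u w).2 huw⟩)

theorem mem_closedNeighborhood {w : G.V} :
    w ∈ closedNeighborhood A ↔ w ∈ A ∨ ∃ u ∈ A, G.graph.Adj u w := by
  simp [closedNeighborhood]

theorem Spans.closedNeighborhood (h : Spans G.graph r A) :
    Spans G.graph r (closedNeighborhood A) := by
  have hA : A ⊆ Pran.closedNeighborhood A := Finset.subset_union_left
  intro w hw
  rcases mem_closedNeighborhood.1 hw with hwA | ⟨u, hu, huw⟩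
  · exact h.reachable_of_subset hA hwA
  · exact (h.reachable_of_subset hA hu).tail ⟨huw, hw⟩

/-- At the end of a traversal with colour `x`, the nodes of `R` have colour `x`, have been visited,
and are connected to the root of the traversal within `R`. -/
structure Grown (x : Fin c) (a : G.Flag) (k : Counter) (b : Boards c G) (R W : Finset G.V) : Prop
    extends AtEnd x a k b where
  root_mem : a.1 ∈ R
  color_eq_of_mem : ∀ u ∈ R, (b u).color = x
  subset : R ⊆ W
  spans : Spans G.graph a.1 R

theorem AtEnd.grown_singleton (h : AtEnd x a k b) (ha : a.1 ∈ W) : Grown x a k b {a.1} W where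
  toAtEnd := h
  root_mem := Finset.mem_singleton_self a.1
  color_eq_of_mem u hu := by rw [Finset.mem_singleton.1 hu, h.color_eq]
  subset := Finset.singleton_subset_iff.2 ha
  spans := Spans.empty.insert

theorem AtEnd.grown_closedNeighborhood (h : AtEnd x a k (paint x A b)) (ha : a.1 ∈ A)
    (hA : Swept x b a.1 A W) : Grown x a k (paint x A b) (closedNeighborhood A) W where
  toAtEnd := h
  root_mem := Finset.mem_union_left _ ha
  color_eq_of_mem w hw := by
    rw [color_paint_eq_iff]
    rcases mem_closedNeighborhood.1 hw with hwA | ⟨u, hu, huw⟩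
    · exact .inl hwA
    · exact (hA.met u hu w huw).2
  subset w hw := by
    rcases mem_closedNeighborhood.1 hw with hwA | ⟨u, hu, huw⟩
    · exact hA.subset hwA
    · exact (hA.met u hu w huw).1
  spans := hA.spans.closedNeighborhood

theorem Swept.grows_closedNeighborhood (hA : Swept y b r A W) (hr : r ∈ A) (hR : Spans G.graph r R)
    (hy : ∀ u ∈ R, (b u).color ≠ y) :
    Grows G.graph (fun v => (b v).color) y R (closedNeighborhood A) :=
  ⟨A, hR.subset hr fun u hu w hw huw => (hA.met u hu w huw).2.resolve_right (hy w hw),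
    Finset.subset_union_left, fun u hu w huw =>
      ⟨mem_closedNeighborhood_of_adj hu huw, (hA.met u hu w huw).2⟩⟩

theorem Grown.traversal (h : Grown x a k b R W) (hyx : y ≠ x) :
    ∃ t a' k' b' R' W',
      Run t (restart hc a y b) (insert (restart hc a y b).loc W) (cfg hc a' y k' b') W' ∧
      Grown y a' k' b' R' W' ∧ Grows G.graph (fun v => (b v).color) y R R' ∧
      t + 1 ≤ 6 * G.numEdges := by
  have := nontrivial_of_port a.2
  have hy : ∀ u ∈ R, (b u).color ≠ y := fun u hu => h.color_eq_of_mem u hu ▸ hyx.symm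
  obtain ⟨t, A, q, k', W', hrun, hend, ha, hA, ht⟩ := traversal_run (hc := hc) (hy _ h.root_mem)
    (Finset.mem_insert_of_mem (h.subset h.root_mem))
    (Finset.mem_insert_self (restart hc a y b).loc W)
  exact ⟨t, ⟨a.1, q⟩, k', paint y A b, closedNeighborhood A, W', hrun,
    hend.grown_closedNeighborhood ha hA, hA.grows_closedNeighborhood ha h.spans hy,
    ht.trans (cost_le A)⟩

end Grown

section CoverTime

variable {x y : Fin c} {a : G.Flag} {k : Counter} {b : Boards c G} {R W : Finset G.V}
  {Ψ : Finset G.V → ℝ}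

theorem Grown.uncovered_eq_zero (h : Grown x a k b R W) {j : ℕ}
    (hj : ∀ v, distTo G.graph R v ≤ j) :
    uncovered (6 * G.numEdges * j) (cfg hc a x k b) W = 0 := by
  induction j generalizing x a k b R W with
  | zero =>
    have hW : W = Finset.univ := Finset.eq_univ_iff_forall.2 fun v => h.subset
      (mem_of_distTo_eq_zero G.connected ⟨a.1, h.root_mem⟩ (Nat.le_zero.1 (hj v)))
    rw [hW, uncovered_univ]
  | succ j ih =>
    have := nontrivial_of_port a.2
    obtain ⟨T, hT⟩ := Nat.exists_eq_succ_of_ne_zero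
      (Nat.mul_pos (Nat.mul_pos (by decide : 0 < 6) G.numEdges_pos) j.succ_pos).ne'
    rw [hT, uncovered, lintegral_step_of_atEnd h.toAtEnd, Finset.sum_eq_zero, mul_zero]
    intro y hy
    obtain ⟨t, a', k', b', R', W', hrun, hG, hgrow, ht⟩ :=
      h.traversal (hc := hc) (Finset.ne_of_mem_erase hy)
    have h0 := ih hG fun v =>
      (hgrow.distTo_le_sub_one G.connected ⟨a.1, h.root_mem⟩ v).trans
        (Nat.sub_le_iff_le_add.2 (hj v))
    rw [← hrun.uncovered_add] at h0
    refine le_antisymm ((uncovered_antitone _ _ ?_).trans h0.le) zero_le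
    rw [Nat.mul_succ] at hT
    omega

theorem Grown.one_add_truncatedCoverTime_le (h : Grown x a k b R W) (hyx : y ≠ x)
    (hΨ : ∀ R, 0 ≤ Ψ R) {T : ℕ}
    (ih : ∀ {a' k' b' R' W'}, Grown y a' k' b' R' W' →
      truncatedCoverTime T (cfg hc a' y k' b') W' ≤ ENNReal.ofReal (6 * G.numEdges * Ψ R')) :
    ∃ R', Grows G.graph (fun v => (b v).color) y R R' ∧
      1 + truncatedCoverTime T (restart hc a y b) (insert (restart hc a y b).loc W) ≤
        ENNReal.ofReal (6 * G.numEdges * (1 + Ψ R')) := by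
  obtain ⟨t, a', k', b', R', W', hrun, hG, hgrow, ht⟩ := h.traversal (hc := hc) hyx
  refine ⟨R', hgrow, ?_⟩
  calc 1 + truncatedCoverTime T (restart hc a y b) (insert (restart hc a y b).loc W)
      ≤ 1 + (t + ENNReal.ofReal (6 * G.numEdges * Ψ R')) := by
        gcongr
        exact (hrun.truncatedCoverTime_le T).trans (by gcongr; exact ih hG)
    _ = ENNReal.ofReal (t + 1) + ENNReal.ofReal (6 * G.numEdges * Ψ R') := by
        rw [ENNReal.ofReal_add t.cast_nonneg zero_le_one, ENNReal.ofReal_natCast,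
          ENNReal.ofReal_one, ← add_assoc, add_comm 1]
    _ = ENNReal.ofReal (t + 1 + 6 * G.numEdges * Ψ R') :=
        (ENNReal.ofReal_add (by positivity) (by have := hΨ R'; positivity)).symm
    _ ≤ ENNReal.ofReal (6 * G.numEdges * (1 + Ψ R')) := by
        have ht' : (t : ℝ) + 1 ≤ 6 * G.numEdges := by exact_mod_cast ht
        exact ENNReal.ofReal_le_ofReal (by linarith)

theorem Grown.truncatedCoverTime_le (hΨ : Supersolution c G.graph Ψ) (T : ℕ)
    (h : Grown x a k b R W) :
    truncatedCoverTime T (cfg hc a x k b) W ≤ ENNReal.ofReal (6 * G.numEdges * Ψ R) := by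
  induction T generalizing x a k b R W with
  | zero => simp [truncatedCoverTime]
  | succ T ih =>
    by_cases hW : W = Finset.univ
    · rw [hW, truncatedCoverTime_univ]
      exact zero_le
    have hR : R ≠ Finset.univ := fun hR => hW (Finset.univ_subset_iff.1 (hR ▸ h.subset))
    choose! Rs hgrow hRs using fun y (hy : y ≠ x) =>
      h.one_add_truncatedCoverTime_le (hc := hc) hy hΨ.nonneg ih
    have hle := hΨ.le (fun v => (b v).color) x R Rs ⟨a.1, h.root_mem⟩ hR h.color_eq_of_mem hgrow
    refine (truncatedCoverTime_succ_le _ _ _).trans ?_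
    rw [lintegral_step_of_atEnd h.toAtEnd,
      ENNReal.inv_mul_le_iff (Nat.cast_ne_zero.2 (by omega)) (ENNReal.natCast_ne_top _)]
    calc ∑ y ∈ Finset.univ.erase x,
          (1 + truncatedCoverTime T (restart hc a y b) (insert (restart hc a y b).loc W))
        ≤ ∑ y ∈ Finset.univ.erase x, ENNReal.ofReal (6 * G.numEdges * (1 + Ψ (Rs y))) :=
          Finset.sum_le_sum fun y hy => hRs y (Finset.ne_of_mem_erase hy)
      _ = ENNReal.ofReal (6 * G.numEdges * ∑ y ∈ Finset.univ.erase x, (1 + Ψ (Rs y))) := by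
          rw [Finset.mul_sum, ENNReal.ofReal_sum_of_nonneg fun y _ => ?_]
          have := hΨ.nonneg (Rs y)
          positivity
      _ ≤ ENNReal.ofReal (6 * G.numEdges * (((c - 1 : ℕ) : ℝ) * Ψ R)) := by gcongr
      _ = ((c - 1 : ℕ) : ℝ≥0∞) * ENNReal.ofReal (6 * G.numEdges * Ψ R) := by
          rw [mul_left_comm, ENNReal.ofReal_mul (Nat.cast_nonneg _), ENNReal.ofReal_natCast]

theorem exists_run_grown (γ : Config (algorithm c hc) G) :
    ∃ t ≤ 19 * G.numEdges, ∃ x a k b W, Run t γ {γ.loc} (cfg hc a x k b) W ∧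
      Grown x a k b {a.1} W :=
  let ⟨t, ht, x, a, k, b, W, hend, hrun⟩ := endsWithin γ {γ.loc}
  ⟨t, ht, x, a, k, b, W, hrun,
    hend.grown_singleton (hrun.loc_mem (Finset.mem_singleton_self γ.loc))⟩

theorem ae_coverTime_le_numEdges_mul_diam (γ : Config (algorithm c hc) G) :
    ∀ᵐ ω ∂execution γ, coverTime ω ≤ ((25 * (G.numEdges * G.diam) : ℕ) : ℕ∞) := by
  have := nontrivial_of_port γ.pin
  obtain ⟨t, ht, x, a, k, b, W, hrun, hG⟩ := exists_run_grown γ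
  have h0 := hG.uncovered_eq_zero (hc := hc)
    (distTo_le_diam G.connected (Finset.singleton_nonempty a.1))
  rw [← hrun.uncovered_add] at h0
  refine ae_coverTime_le (le_antisymm ((uncovered_antitone _ _ ?_).trans h0.le) zero_le)
  have hm : G.numEdges ≤ G.numEdges * G.diam := Nat.le_mul_of_pos_right _ G.diam_pos
  rw [PortGraph.diam] at hm ⊢
  rw [mul_assoc]
  omega

theorem isSelfStabilizingExploration_algorithm (hc : 2 ≤ c) (𝒢 : Set PortGraph.{u}) :
    (algorithm c hc).IsSelfStabilizingExploration 𝒢 := by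
  intro G _ γ
  filter_upwards [ae_coverTime_le_numEdges_mul_diam γ] with ω hω v
  obtain ⟨s, -, hs⟩ := mem_visited.1 (coverTime_le_iff.1 hω ▸ Finset.mem_univ v)
  exact ⟨s, hs⟩

theorem expectedCoverTime_le_numEdges_mul_diam (γ : Config (algorithm c hc) G) :
    expectedCoverTime γ ≤ ENNReal.ofReal (25 * (G.numEdges * G.diam)) := by
  have : IsProbabilityMeasure (execution γ) := by
    rw [execution]
    infer_instance
  calc expectedCoverTime γ
      ≤ ∫⁻ _, ((25 * (G.numEdges * G.diam) : ℕ) : ℝ≥0∞) ∂execution γ :=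
        lintegral_mono_ae <| (ae_coverTime_le_numEdges_mul_diam γ).mono fun ω hω => by
          simpa only [ENat.toENNReal_coe] using ENat.toENNReal_le.2 hω
    _ = ENNReal.ofReal (25 * (G.numEdges * G.diam)) := by
        rw [lintegral_const, measure_univ, mul_one, ← ENNReal.ofReal_natCast]
        push_cast
        rfl

theorem expectedCoverTime_le_of_supersolution (hΨ : Supersolution c G.graph Ψ) {B : ℝ}
    (hB : ∀ r, Ψ {r} ≤ B) (γ : Config (algorithm c hc) G) :
    expectedCoverTime γ ≤ ENNReal.ofReal (G.numEdges * (19 + 6 * B)) := by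
  obtain ⟨t, ht, x, a, k, b, W, hrun, hG⟩ := exists_run_grown γ
  have h0 := hΨ.nonneg {a.1}
  refine expectedCoverTime_le_of_truncated fun T => ?_
  calc truncatedCoverTime T γ {γ.loc}
      ≤ t + ENNReal.ofReal (6 * G.numEdges * Ψ {a.1}) :=
        (hrun.truncatedCoverTime_le T).trans (by gcongr; exact hG.truncatedCoverTime_le hΨ T)
    _ = ENNReal.ofReal (t + 6 * G.numEdges * Ψ {a.1}) := by
        rw [ENNReal.ofReal_add t.cast_nonneg (by positivity), ENNReal.ofReal_natCast]
    _ ≤ ENNReal.ofReal (19 * G.numEdges + 6 * G.numEdges * B) := by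
        gcongr
        · exact_mod_cast ht
        · exact hB a.1
    _ = ENNReal.ofReal (G.numEdges * (19 + 6 * B)) := by ring_nf

end CoverTime

section Bounds

theorem expectedCoverTime_le_of_lt (γ : Config (algorithm c hc) G) (hn : G.numNodes < c) :
    expectedCoverTime γ ≤ ENNReal.ofReal
      (31 * (G.numEdges * ⌈(G.numNodes : ℝ) / (c - G.numNodes)⌉)) := by
  have := nontrivial_of_port γ.pin
  have hpos : (0 : ℝ) < c - G.numNodes := sub_pos.2 (by exact_mod_cast hn)
  have hn0 : (0 : ℝ) < G.numNodes := by exact_mod_cast Fintype.card_pos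
  have hB : ∀ r : G.V, (if ({r} : Finset G.V) = Finset.univ then 0 else
      ((c - 1 : ℕ) : ℝ) / (c - G.numNodes)) ≤ 1 + G.numNodes / (c - G.numNodes) := by
    intro r
    rw [if_neg (Finset.singleton_ne_univ r), Nat.cast_pred (by omega), one_add_div hpos.ne']
    gcongr
    linarith
  refine (expectedCoverTime_le_of_supersolution (supersolution_of_card_lt G.connected hn) hB
    γ).trans (ENNReal.ofReal_le_ofReal ?_)
  have hle := Int.le_ceil ((G.numNodes : ℝ) / (c - G.numNodes))
  have hone : (1 : ℝ) ≤ ⌈(G.numNodes : ℝ) / (c - G.numNodes)⌉ := by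
    exact_mod_cast Int.one_le_ceil_iff.2 (div_pos hn0 hpos)
  rw [mul_left_comm]
  gcongr
  linarith

theorem expectedCoverTime_le_ceil_div_max (γ : Config (algorithm c hc) G) :
    expectedCoverTime γ ≤ ENNReal.ofReal (31 * (G.numEdges *
      ⌈(G.numNodes : ℝ) / max ((c : ℝ) - G.numNodes) ((G.numNodes : ℝ) / G.diam)⌉)) := by
  have := nontrivial_of_port γ.pin
  have hn : (0 : ℝ) < G.numNodes := by exact_mod_cast Fintype.card_pos
  have hD : (0 : ℝ) < G.diam := by exact_mod_cast G.diam_pos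
  rcases le_or_gt ((c : ℝ) - G.numNodes) ((G.numNodes : ℝ) / G.diam) with h | h
  · rw [max_eq_right h, div_div_cancel₀ hn.ne', Int.ceil_natCast, Int.cast_natCast]
    refine (expectedCoverTime_le_numEdges_mul_diam γ).trans ?_
    gcongr
    norm_num
  · rw [max_eq_left h.le]
    exact expectedCoverTime_le_of_lt γ (by exact_mod_cast sub_pos.1 ((div_pos hn hD).trans h))

theorem expectedCoverTime_le_ceil_mul_log (γ : Config (algorithm c hc) G) :
    expectedCoverTime γ ≤ ENNReal.ofReal
      (125 * (G.numEdges * ⌈(G.diam : ℝ) / c⌉ * Real.log G.numNodes)) := by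
  have := nontrivial_of_port γ.pin
  have hD : (0 : ℝ) < G.diam := by exact_mod_cast G.diam_pos
  have hc0 : (0 : ℝ) < c := by exact_mod_cast zero_lt_two.trans_le hc
  have hlog : (0.69 : ℝ) ≤ Real.log G.numNodes := by
    have := Real.log_le_log two_pos
      (by exact_mod_cast Fintype.one_lt_card (α := G.V) : (2 : ℝ) ≤ G.numNodes)
    linarith [Real.log_two_gt_d9]
  have hB : ∀ r : G.V, logPotential c G.graph {r} ≤
      3 * (1 + (Real.log G.numNodes + 2 * (G.diam / c))) := fun r => by
    rw [logPotential, if_neg (Finset.singleton_ne_univ r)]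
    gcongr
    exact log_totalWeight_le hc G.connected (Finset.singleton_nonempty r)
      (Finset.singleton_ne_univ r)
  refine (expectedCoverTime_le_of_supersolution (supersolution_logPotential c G.connected) hB
    γ).trans (ENNReal.ofReal_le_ofReal ?_)
  have hle := Int.le_ceil ((G.diam : ℝ) / c)
  have hone : (1 : ℝ) ≤ ⌈(G.diam : ℝ) / c⌉ := by
    exact_mod_cast Int.one_le_ceil_iff.2 (div_pos hD hc0)
  rw [mul_assoc (G.numEdges : ℝ), mul_left_comm 125]
  gcongr
  have hmul := mul_le_mul_of_nonneg_left hlog (zero_le_one.trans hone)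
  have hmul' := le_mul_of_one_le_left (by linarith : 0 ≤ Real.log G.numNodes) hone
  linarith

end Bounds

section MemorySpace

theorem card_memory_le (c : ℕ) : Nat.card (Memory c) ≤ c * 7 := by
  have hinj : Function.Injective fun s : Memory c => (s.color, s.counter) := by
    rintro ⟨a, b⟩ ⟨a', b'⟩ h
    simpa using h
  refine (Nat.card_le_card_of_injective _ hinj).trans_eq ?_
  rw [Nat.card_prod, Nat.card_eq_fintype_card, Nat.card_eq_fintype_card, Fintype.card_fin]
  rfl

theorem card_board_le (c d : ℕ) : Nat.card (Board c d) ≤ (d + 1) * c := by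
  have hinj : Function.Injective fun s : Board c d => (s.parent, s.color) := by
    rintro ⟨a, b⟩ ⟨a', b'⟩ h
    simpa using h
  refine (Nat.card_le_card_of_injective _ hinj).trans_eq ?_
  rw [Nat.card_prod, Nat.card_eq_fintype_card, Nat.card_eq_fintype_card, Fintype.card_fin,
    Fintype.card_option, Fintype.card_fin]

theorem logb_natCast_nonneg (N : ℕ) : 0 ≤ Real.logb 2 N :=
  div_nonneg (Real.log_natCast_nonneg N) (Real.log_nonneg one_le_two)

theorem logb_natCast_le {M N : ℕ} (h : M ≤ N) : Real.logb 2 M ≤ Real.logb 2 N := by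
  rcases M.eq_zero_or_pos with rfl | hM
  · simpa using logb_natCast_nonneg N
  · exact Real.logb_le_logb_of_le one_lt_two (by exact_mod_cast hM) (by exact_mod_cast h)

theorem agentMemory_le (hc : 2 ≤ c) : (algorithm c hc).agentMemory ≤ 4 * Real.logb 2 c := by
  have hpow : c * 7 ≤ c ^ 4 := by nlinarith [Nat.pow_le_pow_left hc 3]
  calc Real.logb 2 (Nat.card (Memory c)) ≤ Real.logb 2 ((c ^ 4 : ℕ) : ℝ) :=
        logb_natCast_le ((card_memory_le c).trans hpow)
    _ = 4 * Real.logb 2 c := by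
        rw [Nat.cast_pow, Real.logb_pow, Nat.cast_ofNat]

theorem whiteboardMemory_le (hc : 2 ≤ c) (d : ℕ) :
    (algorithm c hc).whiteboardMemory d ≤ 2 * (Real.logb 2 c + Real.logb 2 d) := by
  change Real.logb 2 (Nat.card (Board c d)) ≤ _
  rcases d.eq_zero_or_pos with rfl | hd
  · have h := logb_natCast_le ((card_board_le c 0).trans_eq (by rw [zero_add, one_mul]))
    rw [Nat.cast_zero, Real.logb_zero, add_zero]
    linarith [logb_natCast_nonneg c]
  · have hcard : (d + 1) * c ≤ c ^ 2 * d := by nlinarith [Nat.mul_le_mul hd hc]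
    calc Real.logb 2 (Nat.card (Board c d)) ≤ Real.logb 2 ((c ^ 2 * d : ℕ) : ℝ) :=
          logb_natCast_le ((card_board_le c d).trans hcard)
      _ = 2 * Real.logb 2 c + Real.logb 2 d := by
          rw [Nat.cast_mul, Nat.cast_pow, Real.logb_mul (by positivity) (by positivity),
            Real.logb_pow, Nat.cast_ofNat]
      _ ≤ 2 * (Real.logb 2 c + Real.logb 2 d) := by linarith [logb_natCast_nonneg d]

end MemorySpace

end Pran

theorem theorem1 :
    ∃ C : ℕ, ∀ (c : ℕ) (hc : 2 ≤ c),
      -- self-stabilizing exploration on all simple, undirected, connected port-labelled graphs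
      (Pran.algorithm c hc).IsSelfStabilizingExploration (Set.univ : Set PortGraph.{u}) ∧
      -- the cover time is `O(mD)` with probability 1
      (∀ (G : PortGraph.{u}) (γ : AgentAlgorithm.Config (Pran.algorithm c hc) G),
        ∀ᵐ ω ∂(AgentAlgorithm.execution γ),
          AgentAlgorithm.coverTime ω ≤ ((C * (G.numEdges * G.diam) : ℕ) : ℕ∞)) ∧
      -- the expected cover time
      (∀ (G : PortGraph.{u}) (γ : AgentAlgorithm.Config (Pran.algorithm c hc) G),
        AgentAlgorithm.expectedCoverTime γ ≤ ENNReal.ofReal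
          (C * min
            (G.numEdges *
              (⌈(G.numNodes : ℝ) / max ((c : ℝ) - G.numNodes) ((G.numNodes : ℝ) / G.diam)⌉ : ℝ))
            (G.numEdges * (⌈(G.diam : ℝ) / c⌉ : ℝ) * Real.log G.numNodes))) ∧
      -- the agent memory space
      (Pran.algorithm c hc).agentMemory ≤ C * Real.logb 2 c ∧
      -- the whiteboard memory space
      (∀ (G : PortGraph.{u}) (v : G.V),
        (Pran.algorithm c hc).whiteboardMemory (G.deg v) ≤
          C * (Real.logb 2 c + Real.logb 2 (G.deg v))) := by
  refine ⟨125, fun c hc => ⟨Pran.isSelfStabilizingExploration_algorithm hc _, fun G γ => ?_,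
    fun G γ => ?_, (Pran.agentMemory_le hc).trans ?_,
    fun G v => (Pran.whiteboardMemory_le hc _).trans ?_⟩⟩
  · filter_upwards [Pran.ae_coverTime_le_numEdges_mul_diam γ] with ω hω
    exact hω.trans (by gcongr; norm_num)
  · rw [mul_min_of_nonneg _ _ (Nat.cast_nonneg 125), ENNReal.ofReal_min]
    refine le_min ((Pran.expectedCoverTime_le_ceil_div_max γ).trans ?_)
      (by exact_mod_cast Pran.expectedCoverTime_le_ceil_mul_log γ)
    gcongr
    norm_num
  · gcongr
    exacts [Pran.logb_natCast_nonneg c, by norm_num]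
  · gcongr
    exacts [add_nonneg (Pran.logb_natCast_nonneg c) (Pran.logb_natCast_nonneg _), by norm_num]
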